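/- **Setting.** Let $R$ be an unbounded complete separable metric space with its Borel sets, $m$ a locally finite (Radon) Borel measure on $R$, $o\in R$, and $(b_r)_{r\in\mathbb N}$ an increasing sequence of positive numbers with $b_r\to\infty$; put $S_r=\{x: d(o,x)<b_r\}$. Let $Q$ be the set of locally finite configurations, i.e. of measures $\mathsf s=\sum_i\delta_{s_i}$ on $R$ that are finite on bounded sets, with the vague topology (generated by $\mathsf s\mapsto\int f\,d\mathsf s$ for bounded continuous $f$ with bounded support; if $R$ is locally compact, one may instead take continuous $f$ with compact support) and its Borel sets. Let $Q_n=\{\mathsf s\in Q:\mathsf s(R)=n\}$ and $Q_{\rm fin}=\bigsqcup_{n\ge0}Q_n$. For $\mathsf s\in Q$ let $\pi_r\mathsf s$ and $\pi_r^c\mathsf s$ be the restrictions of $\mathsf s$ to $S_r$ and to $R\setminus S_r$. Let $\mu,\nu$ be Borel probability measures on $Q$ with $m$-approximating sequences $(\mu^n)_{n\ge1}$, $(\nu^n)_{n\ge1}$. This means (for $\mu$; likewise for $\nu$) that there is $f_\mu:Q_{\rm fin}\to[0,\infty)$ for which all the functions $f_\mu(x_1,\dots,x_n)=f_\mu(\sum_i\delta_{x_i})$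 are continuous on $R^n$, that $0<\mathcal Z(\mu^n)=\int_{R^n}f_\mu\,dm^{\otimes n}<\infty$, that $\mu^n$ is the image of $\mathcal Z(\mu^n)^{-1}f_\mu\,dm^{\otimes n}$ under $(x_1,\dots,x_n)\mapsto\sum_i\delta_{x_i}$, and that $\mu^n\to\mu$ weakly. Put $h=f_\mu/f_\nu:Q_{\rm fin}\to[0,\infty]$, with $h=\infty$ where $f_\nu=0$; $h_r=h\circ\pi_r$ on $Q$; $h_r^c=h\circ\pi_r^c$ on $Q_{\rm fin}$. For a non-decreasing sequence $a_k>0$ let $\mathcal H_k=\{\mathsf s\in Q: a_k^{-1}\le\inf_r h_r(\mathsf s)\le\sup_r h_r(\mathsf s)\le a_k\}$. **Assumptions.** (A1) For every $r$ the sets of discontinuity points of $\pi_r:Q\to Q$ and of $h_r:Q\to[0,\infty]$ are $\mu$-null and $\nu$-null. (A2) $(\mu^n)$ and $(\nu^n)$ are $m$-approximating sequences of $\mu$ and $\nu$, as above. (A3) $\lim_{k}\liminf_{n}\mu^n(\mathcal H_k)=\lim_{k}\liminf_{n}\nu^n(\mathcal H_k)=1$. (A4) For every $r$, $h(\mathsf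 s)=h_r(\mathsf s)\,h_r^c(\mathsf s)$ for every $\mathsf s\in Q_{\rm fin}$ for which the product is defined (is not $0\cdot\infty$). (A5) For every $k$, $\lim_{r\to\infty}\sup_{n\ge1}\int|h_r^c-1|\,d\nu^n(\,\cdot\,|\mathcal H_k)=0$, where those $n$ with $\nu^n(\mathcal H_k)=0$ impose nothing. **Theorem.** (i) There are a strictly increasing sequence $(n_p)$ and an index $k_0$ such that for every $k\ge k_0$ the limits $\lim_p\nu^{n_p}(\mathcal H_k)>0$ and $\nu_k=\lim_p\nu^{n_p}(\,\cdot\,|\mathcal H_k)$ (weakly, $\nu_k$ a probability measure) exist. (ii) There is a non-negative $h_\infty\in L^1(\nu)$, independent of the subsequence, such that $h_r\to h_\infty$ weakly in $L^1(\nu_k)$ as $r\to\infty$ whenever, for some $k$ and some $(n_p)$, the limits $\lim_p\nu^{n_p}(\mathcal H_k)>0$ and $\nu_k=\lim_p\nu^{n_p}(\,\cdot\,|\mathcal H_k)$ exist as in (i). For any $(n_p)$, $k_0$ as in (i), $h_\infty$ is the $\nu$-a.e. unique element of $L^1(\nu)$ with $h_r\to h_\infty$ weakly in $L^1(\nu_k)$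 for all $k\ge k_0$. (iii) The limit $\zeta=\lim_{n\to\infty}\mathcal Z(\nu^n)/\mathcal Z(\mu^n)$ exists and lies in $(0,\infty)$. (iv) $\mu\ll\nu$, and $\dfrac{d\mu}{d\nu}=\zeta\,h_\infty$ $\nu$-a.e. -/

import Mathlib

open MeasureTheory Filter Topology Set
open scoped ENNReal NNReal BoundedContinuousFunction

/-- The locally finite configurations `s = ∑ i, δ_{s i}` over a metric space `R`: the Borel measures
on `R` with values in `{0, 1, 2, …, ∞}` which are finite on bounded sets. -/
structure Conf (R : Type*) [MetricSpace R] [MeasurableSpace R] where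
  /-- the underlying measure on `R` -/
  toMeasure : Measure R
  integer_valued : ∀ B : Set R, MeasurableSet B → ∃ n : ℕ∞, toMeasure B = (n : ℝ≥0∞)
  finite_on_balls : ∀ (x : R) (ρ : ℝ), toMeasure (Metric.ball x ρ) < ∞

/-- The finite configurations `Q_fin = ⊔ₙ Qₙ`. -/
def FinConf (R : Type*) [MetricSpace R] [MeasurableSpace R] : Type _ :=
  {s : Conf R // s.toMeasure univ < ∞}

/-- The topology on the configurations generated by the maps `s ↦ ∫ f ds`, where `f` runs through
the bounded continuous functions that vanish outside some member of `𝓚`. -/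
@[reducible]
noncomputable def testTopology {R : Type*} [MetricSpace R] [MeasurableSpace R] (𝓚 : Set (Set R)) :
    TopologicalSpace (Conf R) :=
  ⨅ f ∈ {f : R →ᵇ ℝ | ∃ K ∈ 𝓚, Function.support f ⊆ K},
    TopologicalSpace.induced (fun s : Conf R => ∫ x, f x ∂s.toMeasure) inferInstance

/-- The vague topology on the locally finite configurations: for a complete separable metric space
the test functions are the bounded continuous functions with bounded support; if the space is locally
compact one may also take the continuous functions with compact support. (Where closed balls are
compact, the two topologies coincide.) -/
def IsVagueTopology {R : Type*} [MetricSpace R] [MeasurableSpace R]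
    (τ : TopologicalSpace (Conf R)) : Prop :=
  τ = testTopology {K : Set R | Bornology.IsBounded K} ∨
    (LocallyCompactSpace R ∧ τ = testTopology {K : Set R | IsCompact K})

section Operations

variable {R : Type*} [MetricSpace R] [MeasurableSpace R]

/-- The finite configuration `∑ i, δ_{x i}`. -/
noncomputable def ofPoints {n : ℕ} (x : Fin n → R) : FinConf R :=
  ⟨{ toMeasure := ∑ i, Measure.dirac (x i)
     integer_valued := by
       classical
       intro B hB
       refine ⟨((∑ i, if x i ∈ B then 1 else 0 : ℕ) : ℕ∞), ?_⟩
       simp [Measure.finsetSum_apply, Measure.dirac_apply' _ hB, Set.indicator_apply]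
     finite_on_balls := fun _ _ => measure_lt_top _ _ }, measure_lt_top _ _⟩

/-- The restriction of a configuration to a measurable set. -/
noncomputable def Conf.restrict (s : Conf R) (A : Set R) (hA : MeasurableSet A) : Conf R where
  toMeasure := s.toMeasure.restrict A
  integer_valued := by
    intro B hB
    rw [Measure.restrict_apply hB]
    exact s.integer_valued _ (hB.inter hA)
  finite_on_balls := fun x ρ =>
    lt_of_le_of_lt (Measure.restrict_apply_le _ _) (s.finite_on_balls x ρ)

variable [BorelSpace R]

/-- `π_r s`: the points of `s` in the open ball `S` of radius `ρ` around `o`. -/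
noncomputable def inside (o : R) (ρ : ℝ) (s : Conf R) : FinConf R :=
  ⟨s.restrict (Metric.ball o ρ) measurableSet_ball, by
    change s.toMeasure.restrict (Metric.ball o ρ) univ < ∞
    rw [Measure.restrict_apply_univ]
    exact s.finite_on_balls o ρ⟩

/-- `π_r^c s`: the points of the finite configuration `s` outside the open ball of radius `ρ`
around `o`. -/
noncomputable def outside (o : R) (ρ : ℝ) (s : FinConf R) : FinConf R :=
  ⟨s.1.restrict (Metric.ball o ρ)ᶜ measurableSet_ball.compl, by
    change s.1.toMeasure.restrict (Metric.ball o ρ)ᶜ univ < ∞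
    exact lt_of_le_of_lt (Measure.restrict_apply_le _ _) s.2⟩

/-- The ratio `f / g : Q_fin → [0, ∞]`, equal to `∞` where the quotient is not defined. -/
noncomputable def ratio (f g : FinConf R → ℝ≥0) (s : FinConf R) : ℝ≥0∞ :=
  open Classical in if g s = 0 then ∞ else ((f s / g s : ℝ≥0) : ℝ≥0∞)

/-- `h_r(s) = h(π_r s)`, a function on all locally finite configurations. -/
noncomputable def innerPart (h : FinConf R → ℝ≥0∞) (o : R) (b : ℕ → ℝ) (r : ℕ) (s : Conf R) :
    ℝ≥0∞ :=
  h (inside o (b r) s)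

/-- `h_r^c(s) = h(π_r^c s)`, a function on the finite configurations. -/
noncomputable def outerPart (h : FinConf R → ℝ≥0∞) (o : R) (b : ℕ → ℝ) (r : ℕ) (s : FinConf R) :
    ℝ≥0∞ :=
  h (outside o (b r) s)

/-- `|h_r^c - 1|` with values in `[0, ∞]`, on the finite configurations. It is extended by `0` to the
infinite configurations, and it is only integrated against measures that live on `n`-point
configurations. -/
noncomputable def outerDeviation (h : FinConf R → ℝ≥0∞) (o : R) (b : ℕ → ℝ) (r : ℕ) (s : Conf R) :
    ℝ≥0∞ :=
  open Classical in
  if hs : s.toMeasure univ < ∞ then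
    (outerPart h o b r ⟨s, hs⟩ - 1) + (1 - outerPart h o b r ⟨s, hs⟩)
  else 0

/-- `𝓗_k = {s ; a_k⁻¹ ≤ inf_r h_r(s) ≤ sup_r h_r(s) ≤ a_k}`. -/
def levelSet (h : FinConf R → ℝ≥0∞) (o : R) (b : ℕ → ℝ) (a : ℕ → ℝ) (k : ℕ) : Set (Conf R) :=
  {s | ENNReal.ofReal (a k)⁻¹ ≤ ⨅ r, innerPart h o b r s ∧
    ⨆ r, innerPart h o b r s ≤ ENNReal.ofReal (a k)}

end Operations

/-- Weak convergence of measures: convergence of the integrals of bounded continuous functions. -/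
def WeaklyTendsto {X : Type*} [TopologicalSpace X] [MeasurableSpace X]
    (ρs : ℕ → Measure X) (ρ : Measure X) : Prop :=
  ∀ φ : X →ᵇ ℝ, Tendsto (fun n => ∫ s, φ s ∂(ρs n)) atTop (𝓝 (∫ s, φ s ∂ρ))

/-- The normalisation `Z = ∫_{Rⁿ} f dm^{⊗n}`. -/
noncomputable def partitionFn {R : Type*} [MetricSpace R] [MeasurableSpace R]
    (m : Measure R) (f : FinConf R → ℝ≥0) (n : ℕ) : ℝ≥0∞ :=
  ∫⁻ x : Fin n → R, (f (ofPoints x) : ℝ≥0∞) ∂(Measure.pi fun _ => m)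

/-- `μs` is an `m`-approximating sequence of `μ` with density `f`: for `n ≥ 1`, `μs n` is the law of
the `n`-point configuration whose labelled points have the density `Z⁻¹ f` with respect to `m^{⊗n}`,
`f` is continuous on each `Rⁿ`, and `μs n → μ` weakly. -/
structure IsApproxSeq {R : Type*} [MetricSpace R] [MeasurableSpace R]
    [TopologicalSpace (Conf R)] [MeasurableSpace (Conf R)]
    (m : Measure R) (μ : Measure (Conf R)) (μs : ℕ → Measure (Conf R)) (f : FinConf R → ℝ≥0) :
    Prop where
  continuous : ∀ n : ℕ, Continuous fun x : Fin n → R => f (ofPoints x)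
  partitionFn_pos : ∀ n : ℕ, 1 ≤ n → 0 < partitionFn m f n
  partitionFn_lt_top : ∀ n : ℕ, 1 ≤ n → partitionFn m f n < ∞
  law : ∀ n : ℕ, 1 ≤ n → μs n = (partitionFn m f n)⁻¹ •
    ((Measure.pi fun _ : Fin n => m).withDensity
      fun x => (f (ofPoints x) : ℝ≥0∞)).map (fun x => (ofPoints x).1)
  weakly : WeaklyTendsto μs μ

/-- `ρ` is the weak limit, along the subsequence `p ↦ n p`, of the conditional laws `ρs n ( · | A)`,
and `ρs (n p) A` has a positive limit. -/
def IsConditionalLimit {X : Type*} [TopologicalSpace X] [MeasurableSpace X]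
    (ρs : ℕ → Measure X) (A : Set X) (n : ℕ → ℕ) (ρ : Measure X) : Prop :=
  StrictMono n ∧ IsProbabilityMeasure ρ ∧
    (∃ α : ℝ≥0∞, 0 < α ∧ Tendsto (fun p => ρs (n p) A) atTop (𝓝 α)) ∧
    WeaklyTendsto (fun p => ProbabilityTheory.cond (ρs (n p)) A) ρ

/-- The `[0, ∞]`-valued functions `F r` are in `L¹(ρ)` and converge weakly in `L¹(ρ)` to `g`, i.e.
when tested against every function in `L^∞(ρ)`. -/
def WeakL1Limit {X : Type*} [MeasurableSpace X] (ρ : Measure X) (F : ℕ → X → ℝ≥0∞) (g : X → ℝ) :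
    Prop :=
  (∀ r, AEMeasurable (F r) ρ ∧ ∫⁻ s, F r s ∂ρ < ∞) ∧ Integrable g ρ ∧
    ∀ φ : X → ℝ, MemLp φ ∞ ρ →
      Tendsto (fun r => ∫ s, φ s * (F r s).toReal ∂ρ) atTop (𝓝 (∫ s, φ s * g s ∂ρ))

/-!
The functions `h_r` converge strongly, not only weakly, in `L¹` of every conditional limit, and this
makes the limit `h_∞` independent of the subsequence. On the level set `𝓗_k` the factorisation
`h = h_r * h_r^c` gives `|h_r - h| ≤ a_k |h_r^c - 1|`, which is small in `L¹` of `νs n ( · | 𝓗_k)`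
uniformly in `n`. Although `h` is only defined on finite configurations, the difference
`|h_r - h_r'|` is defined everywhere and `ν`-almost everywhere continuous, so its integral passes to
the weak limit `ν_k` (`WeaklyTendsto.tendsto_integral_of_ae_continuousAt`,
`IsRatioApprox.integral_abs_compress_sub_le`). To avoid all questions of integrability, `h_r` is
replaced by `1 / (1 + h_r)`, which takes values in `[0, 1]`. If `α_k` is the limit of `νs n 𝓗_k`,
then `α_k ν_k ≤ ν` and `α_k → 1`; hence `1 / (1 + h_r)` is a Cauchy sequence in `L¹(ν)`
(`IsRatioApprox.exists_limit_compress`), and its limit determines `h_∞`.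

On `𝓗_k` the law `μs n` has the density `z n * h` with respect to `νs n`, where `z n` is the ratio
of the normalisations. Replacing `h` by `h_r` and letting `n → ∞` and then `r → ∞` shows that `μ`
and `ζ α_k h_∞ ν_k` differ on bounded continuous functions by at most the mass which the `μs n` lose
outside `𝓗_k` (`IsRatioApprox.abs_integral_sub_limit_le`), for every limit point `ζ` of `z`. As
`k → ∞` this becomes `μ = ζ h_∞ ν` (`IsRatioApprox.lintegral_eq`). Total mass one forces
`ζ = 1 / ∫ h_∞ dν`, so that `z` converges.

The conditional limits exist because the restrictions of `νs n` are dominated by a weakly convergent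
sequence: after a diagonal extraction the limit functional is continuous for the norm of `L²(ν)`,
and the Riesz representation there yields a measure (`exists_subseq_weaklyTendsto_restrict`). This
needs a second countable, pseudo-metrizable space of configurations but neither tightness nor
completeness. That space has a countable subbasis (`IsCutoff.testTopology_eq_generateFrom`), and
`h_r` is Borel on it because finite configurations are Borel images of labelled points, to which the
Lusin separation theorem applies (`measurable_extendFin`).
-/

/-! ### Weak convergence and almost everywhere continuous functions -/

section WeakConvergence

variable {X : Type*} [MeasurableSpace X]

theorem integrable_of_forall_abs_le {ρ : Measure X} [IsFiniteMeasure ρ] {F : X → ℝ}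
    (hF : AEStronglyMeasurable F ρ) {C : ℝ} (hC : ∀ x, |F x| ≤ C) : Integrable F ρ :=
  Integrable.of_bound hF C (Eventually.of_forall hC)

variable [TopologicalSpace X]

/-- The order of finite measures on a metrizable space may be tested on nonnegative bounded
continuous functions. -/
theorem measure_le_of_forall_integral_le [TopologicalSpace.PseudoMetrizableSpace X] [BorelSpace X]
    {ρ σ : Measure X} [IsFiniteMeasure ρ] [IsFiniteMeasure σ]
    (h : ∀ φ : X →ᵇ ℝ, (∀ x, 0 ≤ φ x) → ∫ x, φ x ∂ρ ≤ ∫ x, φ x ∂σ) : ρ ≤ σ := by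
  have hclosed : ∀ F : Set X, IsClosed F → ρ F ≤ σ F := by
    intro F hF
    refine ge_of_tendsto' (HasOuterApproxClosed.tendsto_lintegral_apprSeq hF σ) fun n => ?_
    refine (HasOuterApproxClosed.measure_le_lintegral hF ρ n).trans ?_
    have hfin : ∀ (κ : Measure X) [IsFiniteMeasure κ], ∫⁻ x, (hF.apprSeq n x : ℝ≥0∞) ∂κ ≠ ∞ :=
      fun κ _ => (BoundedContinuousFunction.lintegral_lt_top_of_nnreal κ (hF.apprSeq n)).ne
    rw [← ENNReal.toReal_le_toReal (hfin ρ) (hfin σ),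
      BoundedContinuousFunction.toReal_lintegral_coe_eq_integral,
      BoundedContinuousFunction.toReal_lintegral_coe_eq_integral]
    exact h ((hF.apprSeq n).comp _ (LipschitzWith.of_edist_le (f := ((↑) : ℝ≥0 → ℝ))
      fun _ _ => le_rfl)) fun x => NNReal.coe_nonneg _
  refine Measure.le_iff.2 fun A hA => ?_
  rw [hA.measure_eq_iSup_isClosed_of_ne_top (measure_ne_top ρ A)]
  exact iSup_le fun K => iSup_le fun hK => iSup_le fun hKc =>
    (hclosed K hKc).trans (measure_mono hK)

/-- The Lipschitz regularisations `x ↦ inf_y (F y + j d(x, y))` approximate a bounded function from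
below; they converge to `F` at its points of continuity. -/
theorem exists_boundedContinuous_le_of_ae_continuousAt
    [TopologicalSpace.PseudoMetrizableSpace X] [BorelSpace X]
    {ρ : Measure X} [IsFiniteMeasure ρ] {F : X → ℝ} {C : ℝ}
    (hC : ∀ x, |F x| ≤ C) (hcont : ∀ᵐ x ∂ρ, ContinuousAt F x) {ε : ℝ} (hε : 0 < ε) :
    ∃ φ : X →ᵇ ℝ, (∀ x, φ x ≤ F x) ∧ ∫ x, F x ∂ρ - ε < ∫ x, φ x ∂ρ := by
  let : PseudoMetricSpace X := TopologicalSpace.pseudoMetrizableSpacePseudoMetric X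
  set e : ℕ → X → ℝ := fun j x => ⨅ y, (F y + j * dist x y) with he
  have hbdd : ∀ (j : ℕ) x, BddBelow (range fun y => F y + j * dist x y) := by
    intro j x
    refine ⟨-C, ?_⟩
    rintro _ ⟨y, rfl⟩
    have := (abs_le.1 (hC y)).1
    have : 0 ≤ (j : ℝ) * dist x y := by positivity
    dsimp only
    linarith
  have hle : ∀ j x, e j x ≤ F x := by
    intro j x
    simpa using ciInf_le (hbdd j x) x
  have hge : ∀ j x, -C ≤ e j x := by
    intro j x
    have : Nonempty X := ⟨x⟩
    refine le_ciInf fun y => ?_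
    have := (abs_le.1 (hC y)).1
    have : 0 ≤ (j : ℝ) * dist x y := by positivity
    linarith
  have habs : ∀ j x, |e j x| ≤ C := fun j x =>
    abs_le.2 ⟨hge j x, (hle j x).trans (abs_le.1 (hC x)).2⟩
  have hlip : ∀ j : ℕ, LipschitzWith (j : ℝ≥0) (e j) := by
    intro j
    refine LipschitzWith.of_le_add_mul _ fun x x' => ?_
    have : Nonempty X := ⟨x⟩
    rw [← sub_le_iff_le_add]
    refine le_ciInf fun y => ?_
    rw [sub_le_iff_le_add]
    refine (ciInf_le (hbdd j x) y).trans ?_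
    have h1 : dist x y ≤ dist x x' + dist x' y := dist_triangle _ _ _
    have h2 : (j : ℝ) * dist x y ≤ j * (dist x x' + dist x' y) := by gcongr
    simp only [NNReal.coe_natCast]
    linarith
  let φ : ℕ → X →ᵇ ℝ := fun j => BoundedContinuousFunction.ofNormedAddCommGroup (e j)
    (hlip j).continuous C (habs j)
  have hlim : ∀ᵐ x ∂ρ, Tendsto (fun j => φ j x) atTop (𝓝 (F x)) := by
    filter_upwards [hcont] with x hx
    rw [Metric.tendsto_atTop]
    intro η hη
    obtain ⟨δ, hδ, hδF⟩ := Metric.continuousAt_iff.1 hx (η / 2) (by positivity)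
    obtain ⟨N, hN⟩ := exists_nat_gt (2 * C / δ)
    refine ⟨N, fun j hj => ?_⟩
    have hlow : F x - η / 2 ≤ e j x := by
      have : Nonempty X := ⟨x⟩
      refine le_ciInf fun y => ?_
      by_cases hy : dist y x < δ
      · have := (abs_lt.1 (by simpa [Real.dist_eq] using hδF hy)).1
        have : 0 ≤ (j : ℝ) * dist x y := by positivity
        linarith
      · rw [not_lt, dist_comm] at hy
        have h1 := (abs_le.1 (hC y)).1
        have h2 := (abs_le.1 (hC x)).2
        have h3 : 2 * C < j * δ := by
          rw [div_lt_iff₀ hδ] at hN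
          have : (N : ℝ) ≤ j := by exact_mod_cast hj
          nlinarith
        have h4 : (j : ℝ) * δ ≤ j * dist x y := by gcongr
        linarith
    have := hle j x
    change dist (e j x) (F x) < η
    rw [Real.dist_eq, abs_lt]
    constructor <;> linarith
  have htend : Tendsto (fun j => ∫ x, φ j x ∂ρ) atTop (𝓝 (∫ x, F x ∂ρ)) := by
    refine tendsto_integral_of_dominated_convergence (fun _ => C)
      (fun j => (φ j).continuous.aestronglyMeasurable) (integrable_const C)
      (fun j => Eventually.of_forall fun x => habs j x) hlim
  obtain ⟨j, hj⟩ := (htend.eventually (lt_mem_nhds (sub_lt_self _ hε))).exists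
  exact ⟨φ j, hle j, hj⟩

/-- Weak convergence may be tested on bounded functions whose discontinuity points are null for the
limit. -/
theorem WeaklyTendsto.tendsto_integral_of_ae_continuousAt
    [TopologicalSpace.PseudoMetrizableSpace X] [BorelSpace X]
    {ρs : ℕ → Measure X} {ρ : Measure X} [∀ p, IsFiniteMeasure (ρs p)] [IsFiniteMeasure ρ]
    (h : WeaklyTendsto ρs ρ) {F : X → ℝ} (hF : Measurable F) {C : ℝ} (hC : ∀ x, |F x| ≤ C)
    (hcont : ∀ᵐ x ∂ρ, ContinuousAt F x) :
    Tendsto (fun p => ∫ x, F x ∂(ρs p)) atTop (𝓝 (∫ x, F x ∂ρ)) := by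
  have key : ∀ G : X → ℝ, Measurable G → (∀ x, |G x| ≤ C) → (∀ᵐ x ∂ρ, ContinuousAt G x) →
      ∀ ε > 0, ∀ᶠ p in atTop, ∫ x, G x ∂ρ - ε < ∫ x, G x ∂(ρs p) := by
    intro G hG hGC hGcont ε hε
    obtain ⟨φ, hφle, hφ⟩ := exists_boundedContinuous_le_of_ae_continuousAt hGC hGcont hε
    filter_upwards [(h φ).eventually (lt_mem_nhds hφ)] with p hp
    exact hp.trans_le (integral_mono (φ.integrable _)
      (integrable_of_forall_abs_le hG.aestronglyMeasurable hGC) hφle)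
  rw [Metric.tendsto_nhds]
  intro ε hε
  filter_upwards [key F hF hC hcont ε hε, key (fun x => -F x) hF.neg (by simpa using hC)
    (hcont.mono fun x hx => hx.neg) ε hε] with p h1 h2
  rw [integral_neg, integral_neg] at h2
  rw [Real.dist_eq, abs_lt]
  constructor <;> linarith

end WeakConvergence

/-! ### Weak subsequential limits of dominated measures -/

section WeakCompactness

variable {X : Type*} [TopologicalSpace X] [MeasurableSpace X] [BorelSpace X]

theorem abs_integral_le_integral_abs_of_le {ρ σ : Measure X} [IsFiniteMeasure σ] (hle : ρ ≤ σ)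
    (φ : X →ᵇ ℝ) : |∫ x, φ x ∂ρ| ≤ ∫ x, |φ x| ∂σ :=
  abs_integral_le_integral_abs.trans <|
    integral_mono_measure hle (Eventually.of_forall fun x => abs_nonneg (φ x)) (φ.integrable σ).abs

theorem sq_integral_abs_le {σ : Measure X} [IsProbabilityMeasure σ] (φ : X →ᵇ ℝ) :
    (∫ x, |φ x| ∂σ) ^ 2 ≤ ∫ x, φ x ^ 2 ∂σ := by
  set c := ∫ x, |φ x| ∂σ with hc
  have h1 : ∫ x, (2 * c * |φ x| - c ^ 2) ∂σ ≤ ∫ x, φ x ^ 2 ∂σ := by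
    refine integral_mono (((φ.integrable σ).abs.const_mul _).sub (integrable_const _))
      (by simpa [sq, Pi.mul_def] using (φ * φ).integrable σ) fun x => ?_
    have := sq_nonneg (|φ x| - c)
    have h2 := sq_abs (φ x)
    dsimp only
    nlinarith
  rw [integral_sub ((φ.integrable σ).abs.const_mul _) (integrable_const _),
    integral_const_mul, ← hc] at h1
  simp only [integral_const, probReal_univ, one_smul] at h1
  nlinarith

theorem norm_sq_toLp_two {ν : Measure X} [IsFiniteMeasure ν] (φ : X →ᵇ ℝ) :
    ‖BoundedContinuousFunction.toLp 2 ν ℝ φ‖ ^ 2 = ∫ x, φ x ^ 2 ∂ν := by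
  rw [← real_inner_self_eq_norm_sq, L2.inner_def]
  refine integral_congr_ae ?_
  filter_upwards [BoundedContinuousFunction.coeFn_toLp 2 ν ℝ φ] with x hx
  rw [hx, real_inner_self_eq_norm_sq, Real.norm_eq_abs, sq_abs]

variable [TopologicalSpace.PseudoMetrizableSpace X]

/-- A limit functional on the bounded continuous functions which is dominated by `ν` extends to
`L²(ν)`, and the Riesz representation theorem there turns it into a measure. -/
theorem exists_weaklyTendsto_of_dominated {ν : Measure X} [IsFiniteMeasure ν]
    {σ τ : ℕ → Measure X} [∀ n, IsProbabilityMeasure (σ n)] (hσ : WeaklyTendsto σ ν)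
    (hle : ∀ n, τ n ≤ σ n)
    (hlim : ∀ φ : X →ᵇ ℝ, ∃ l, Tendsto (fun n => ∫ x, φ x ∂(τ n)) atTop (𝓝 l)) :
    ∃ ρ : Measure X, IsFiniteMeasure ρ ∧ WeaklyTendsto τ ρ := by
  choose Λ hΛ using hlim
  have hint : ∀ n (φ : X →ᵇ ℝ), Integrable φ (τ n) := fun n φ =>
    (φ.integrable (σ n)).mono_measure (hle n)
  let Λₗ : (X →ᵇ ℝ) →ₗ[ℝ] ℝ :=
    { toFun := Λ
      map_add' := fun φ ψ => tendsto_nhds_unique (hΛ (φ + ψ)) <| by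
        refine ((hΛ φ).add (hΛ ψ)).congr fun n => ?_
        exact (integral_add (hint n φ) (hint n ψ)).symm
      map_smul' := fun c φ => tendsto_nhds_unique (hΛ (c • φ)) <| by
        refine ((hΛ φ).const_mul c).congr fun n => ?_
        exact (integral_const_mul c _).symm }
  have hbound : ∀ φ : X →ᵇ ℝ,
      ‖Λₗ φ‖ ≤ 1 * ‖(BoundedContinuousFunction.toLp 2 ν ℝ).toLinearMap φ‖ := by
    intro φ
    rw [one_mul]
    refine abs_le_of_sq_le_sq' ?_ (norm_nonneg _) |> abs_le.2
    refine (le_of_tendsto_of_tendsto' ((hΛ φ).pow 2) (hσ (φ * φ)) fun n => ?_).trans_eq ?_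
    · rw [← sq_abs]
      refine (pow_le_pow_left₀ (abs_nonneg _)
        (abs_integral_le_integral_abs_of_le (hle n) φ) 2).trans ((sq_integral_abs_le φ).trans_eq ?_)
      simp [sq]
    · refine Eq.trans ?_ (norm_sq_toLp_two φ).symm
      simp [sq]
  have hdense : DenseRange (BoundedContinuousFunction.toLp 2 ν ℝ : (X →ᵇ ℝ) →L[ℝ] Lp ℝ 2 ν) :=
    BoundedContinuousFunction.toLp_denseRange ℝ ν ℝ (by simp)
  let g : Lp ℝ 2 ν := (InnerProductSpace.toDual ℝ (Lp ℝ 2 ν)).symm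
    (Λₗ.extendOfNorm (BoundedContinuousFunction.toLp 2 ν ℝ).toLinearMap)
  have hg1 : Integrable g ν := (Lp.memLp g).integrable (by norm_num)
  have hg : ∀ φ : X →ᵇ ℝ, ∫ x, φ x * g x ∂ν = Λ φ := by
    intro φ
    have h1 := LinearMap.extendOfNorm_eq (f := Λₗ)
      (e := (BoundedContinuousFunction.toLp 2 ν ℝ).toLinearMap) hdense ⟨1, hbound⟩ φ
    rw [← InnerProductSpace.toDual_symm_apply, L2.inner_def] at h1
    refine Eq.trans (integral_congr_ae ?_) h1
    filter_upwards [BoundedContinuousFunction.coeFn_toLp 2 ν ℝ φ] with x hx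
    change φ x * g x = (BoundedContinuousFunction.toLp 2 ν ℝ φ) x * g x
    rw [hx]
  have hfinp : IsFiniteMeasure (ν.withDensity fun x => ENNReal.ofReal (g x)) :=
    isFiniteMeasure_withDensity_ofReal hg1.2
  have hfinn : IsFiniteMeasure (ν.withDensity fun x => ENNReal.ofReal (-g x)) :=
    isFiniteMeasure_withDensity_ofReal hg1.neg.2
  have hgm : Measurable g := (Lp.stronglyMeasurable g).measurable
  have hpos : ∀ (u : X → ℝ), Measurable u → ∀ φ : X →ᵇ ℝ,
      ∫ x, φ x ∂(ν.withDensity fun x => ENNReal.ofReal (u x)) = ∫ x, φ x * max (u x) 0 ∂ν := by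
    intro u hu φ
    rw [integral_withDensity_eq_integral_toReal_smul hu.ennreal_ofReal (by simp)]
    refine integral_congr_ae (Eventually.of_forall fun x => ?_)
    simp only [ENNReal.toReal_ofReal', smul_eq_mul]
    ring
  have hgi : ∀ (u : X → ℝ), Integrable u ν → ∀ φ : X →ᵇ ℝ,
      Integrable (fun x => φ x * max (u x) 0) ν := fun u hu φ =>
    hu.pos_part.bdd_mul φ.continuous.aestronglyMeasurable
      (Eventually.of_forall fun x => φ.norm_coe_le_norm x)
  have hdiff : ∀ φ : X →ᵇ ℝ, ∫ x, φ x ∂(ν.withDensity fun x => ENNReal.ofReal (g x)) -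
      ∫ x, φ x ∂(ν.withDensity fun x => ENNReal.ofReal (-g x)) = Λ φ := by
    intro φ
    rw [hpos g hgm, hpos (fun x => -g x) hgm.neg,
      ← integral_sub (hgi g hg1 φ) (hgi (fun x => -g x) hg1.neg φ), ← hg]
    refine integral_congr_ae (Eventually.of_forall fun x => ?_)
    dsimp only [Pi.neg_apply]
    rcases le_total 0 (g x) with h | h
    · rw [max_eq_left h, max_eq_right (by linarith)]; ring
    · rw [max_eq_right h, max_eq_left (by linarith)]; ring
  have hmeas : (ν.withDensity fun x => ENNReal.ofReal (-g x)) ≤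
      ν.withDensity fun x => ENNReal.ofReal (g x) := by
    refine measure_le_of_forall_integral_le fun φ hφ => ?_
    rw [← sub_nonneg, hdiff]
    exact ge_of_tendsto' (hΛ φ) fun n => integral_nonneg hφ
  have hneg : (ν.withDensity fun x => ENNReal.ofReal (-g x)) = 0 := by
    -- the positive part of `g` vanishes where the negative part lives
    have hA : MeasurableSet {x | g x ≤ 0} := measurableSet_le hgm measurable_const
    have h0 : (ν.withDensity fun x => ENNReal.ofReal (g x)) {x | g x ≤ 0} = 0 := by
      rw [withDensity_apply _ hA]
      refine setLIntegral_eq_zero hA fun x hx => ?_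
      simpa using hx
    have h1 : (ν.withDensity fun x => ENNReal.ofReal (-g x)) {x | g x ≤ 0}ᶜ = 0 := by
      rw [withDensity_apply _ hA.compl]
      refine setLIntegral_eq_zero hA.compl fun x hx => ?_
      simp only [mem_compl_iff, mem_ofPred_eq, not_le] at hx
      simpa using hx.le
    rw [← Measure.measure_univ_eq_zero, ← union_compl_self {x | g x ≤ 0}]
    exact measure_union_null (le_antisymm ((hmeas _).trans_eq h0) zero_le) h1
  refine ⟨_, hfinp, fun φ => ?_⟩
  have := hdiff φ
  rw [hneg, integral_zero_measure, sub_zero] at this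
  rw [this]
  exact hΛ φ

/-- Measures dominated by a weakly convergent sequence have weak limits along a subsequence. Since
bounded continuous functions are close in `L¹(ν)` to a fixed countable family of them, it is enough
to make the integrals of that family converge, which a diagonal extraction does. -/
theorem exists_subseq_weaklyTendsto_restrict [SecondCountableTopology X]
    {ν : Measure X} [IsFiniteMeasure ν] {σ : ℕ → Measure X} [∀ n, IsProbabilityMeasure (σ n)]
    (hσ : WeaklyTendsto σ ν) (H : ℕ → Set X) :
    ∃ θ : ℕ → ℕ, StrictMono θ ∧ ∀ k, ∃ ρ : Measure X, IsFiniteMeasure ρ ∧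
      WeaklyTendsto (fun p => (σ (θ p)).restrict (H k)) ρ := by
  let E : (X →ᵇ ℝ) → Lp ℝ 1 ν := BoundedContinuousFunction.toLp 1 ν ℝ
  obtain ⟨D, hDc, hD⟩ : ∃ D : Set (X →ᵇ ℝ), D.Countable ∧ ∀ φ : X →ᵇ ℝ, ∀ ε > 0,
      ∃ ψ ∈ D, dist (E φ) (E ψ) < ε := by
    have hdense : Dense (range E) := BoundedContinuousFunction.toLp_denseRange ℝ ν ℝ (by simp)
    have : Fact ((1 : ℝ≥0∞) ≠ ∞) := ⟨by simp⟩
    obtain ⟨S, hSsub, hSc, hS⟩ := hdense.exists_countable_dense_subset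
    have hpre : ∀ u, u ∈ S → ∃ φ, E φ = u := fun u hu => hSsub hu
    choose! e he using hpre
    refine ⟨e '' S, hSc.image e, fun φ ε hε => ?_⟩
    obtain ⟨u, huS, hu⟩ := hS.exists_dist_lt (E φ) hε
    exact ⟨e u, mem_image_of_mem e huS, by rwa [he u huS]⟩
  have hdist : ∀ φ ψ : X →ᵇ ℝ, dist (E φ) (E ψ) = ∫ x, |(φ - ψ) x| ∂ν := by
    intro φ ψ
    rw [dist_eq_norm]
    have : E φ - E ψ = E (φ - ψ) := (map_sub _ _ _).symm
    rw [this, L1.norm_eq_integral_norm]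
    refine integral_congr_ae ?_
    filter_upwards [BoundedContinuousFunction.coeFn_toLp 1 ν ℝ (φ - ψ)] with x hx
    rw [← Real.norm_eq_abs, ← hx]
  have hDcount := hDc.to_subtype
  have hint : ∀ n k (φ : X →ᵇ ℝ), Integrable φ ((σ n).restrict (H k)) := fun n k φ =>
    φ.integrable _
  let x : ℕ → ℕ × D → ℝ := fun n q => ∫ y, q.2.1 y ∂((σ n).restrict (H q.1))
  have hx : ∀ n, x n ∈ univ.pi fun q : ℕ × D => Icc (-‖q.2.1‖) ‖q.2.1‖ := by
    intro n q _
    refine abs_le.1 ((abs_integral_le_integral_abs_of_le Measure.restrict_le_self _).trans ?_)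
    refine (integral_mono (q.2.1.integrable (σ n)).abs (integrable_const ‖q.2.1‖)
      fun y => q.2.1.norm_coe_le_norm y).trans_eq ?_
    simp
  obtain ⟨l, -, θ, hθ, hl⟩ :=
    (isCompact_univ_pi fun q : ℕ × D => isCompact_Icc).tendsto_subseq hx
  refine ⟨θ, hθ, fun k => ?_⟩
  refine exists_weaklyTendsto_of_dominated (σ := fun p => σ (θ p)) (ν := ν)
    (fun φ => (hσ φ).comp hθ.tendsto_atTop) (fun p => Measure.restrict_le_self) fun φ => ?_
  refine cauchySeq_tendsto_of_complete (Metric.cauchySeq_iff'.2 fun ε hε => ?_)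
  obtain ⟨ψ, hψD, hψ⟩ := hD φ (ε / 4) (by positivity)
  rw [hdist] at hψ
  have h1 : ∀ᶠ p in atTop, ∫ y, |(φ - ψ) y| ∂(σ (θ p)) < ε / 4 := by
    have := (hσ |φ - ψ|).comp hθ.tendsto_atTop
    exact this.eventually (gt_mem_nhds hψ)
  have h2 : ∀ᶠ p in atTop,
      dist (∫ y, ψ y ∂((σ (θ p)).restrict (H k))) (l (k, ⟨ψ, hψD⟩)) < ε / 4 :=
    Metric.tendsto_nhds.1 (tendsto_pi_nhds.1 hl (k, ⟨ψ, hψD⟩)) _ (by positivity)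
  have h3 : ∀ᶠ p in atTop,
      dist (∫ y, φ y ∂((σ (θ p)).restrict (H k))) (l (k, ⟨ψ, hψD⟩)) < ε / 2 := by
    filter_upwards [h1, h2] with p hp1 hp2
    have h4 := (abs_integral_le_integral_abs_of_le (Measure.restrict_le_self (s := H k))
      (φ - ψ)).trans_lt hp1
    have h5 : ∫ y, (φ - ψ) y ∂((σ (θ p)).restrict (H k)) =
        ∫ y, φ y ∂((σ (θ p)).restrict (H k)) - ∫ y, ψ y ∂((σ (θ p)).restrict (H k)) :=
      integral_sub (hint _ k φ) (hint _ k ψ)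
    rw [h5] at h4
    refine (dist_triangle _ (∫ y, ψ y ∂((σ (θ p)).restrict (H k))) _).trans_lt ?_
    rw [Real.dist_eq]
    linarith
  obtain ⟨N, hN⟩ := eventually_atTop.1 h3
  refine ⟨N, fun p hp => (dist_triangle_right _ _ (l (k, ⟨ψ, hψD⟩))).trans_lt ?_⟩
  linarith [hN p hp, hN N le_rfl]

end WeakCompactness

/-! ### Compressing `[0, ∞]`, and measures dominated by `ν` -/

section Compression

/-- The decreasing homeomorphism `t ↦ 1 / (1 + t)` of `[0, ∞]` onto `[0, 1]`. -/
noncomputable def compress (t : ℝ≥0∞) : ℝ := ((1 + t)⁻¹).toReal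

theorem one_add_inv_ne_top (t : ℝ≥0∞) : (1 + t)⁻¹ ≠ ∞ := by simp

theorem continuous_compress : Continuous compress := by
  refine ENNReal.continuousOn_toReal.comp_continuous ?_ fun t => one_add_inv_ne_top t
  fun_prop

theorem compress_nonneg (t : ℝ≥0∞) : 0 ≤ compress t := ENNReal.toReal_nonneg

theorem compress_le_one (t : ℝ≥0∞) : compress t ≤ 1 := by
  refine ENNReal.toReal_le_of_le_ofReal zero_le_one ?_
  simp

theorem abs_compress_le_one (t : ℝ≥0∞) : |compress t| ≤ 1 := by
  rw [abs_of_nonneg (compress_nonneg t)]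
  exact compress_le_one t

theorem compress_le_compress_iff {t u : ℝ≥0∞} : compress t ≤ compress u ↔ u ≤ t := by
  rw [compress, compress, ENNReal.toReal_le_toReal (one_add_inv_ne_top t) (one_add_inv_ne_top u),
    ENNReal.inv_le_inv, ENNReal.add_le_add_iff_left (by simp)]

theorem compress_ofReal {x : ℝ} (hx : 0 ≤ x) : compress (ENNReal.ofReal x) = (1 + x)⁻¹ := by
  rw [compress, ENNReal.toReal_inv, ENNReal.toReal_add (by simp) (by simp),
    ENNReal.toReal_ofReal hx, ENNReal.toReal_one]

theorem compress_of_ne_top {t : ℝ≥0∞} (ht : t ≠ ∞) : compress t = (1 + t.toReal)⁻¹ := by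
  rw [← compress_ofReal ENNReal.toReal_nonneg, ENNReal.ofReal_toReal ht]

theorem ofReal_abs_toReal_sub_le {t u : ℝ≥0∞} (ht : t ≠ ∞) (hu : u ≠ ∞) :
    ENNReal.ofReal |t.toReal - u.toReal| ≤ (t - u) + (u - t) := by
  rcases le_total t u with h | h
  · rw [abs_sub_comm, abs_of_nonneg (sub_nonneg.2 (ENNReal.toReal_mono hu h)),
      ← ENNReal.toReal_sub_of_le h hu, ENNReal.ofReal_toReal (ENNReal.sub_ne_top hu)]
    exact le_add_self
  · rw [abs_of_nonneg (sub_nonneg.2 (ENNReal.toReal_mono ht h)),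
      ← ENNReal.toReal_sub_of_le h ht, ENNReal.ofReal_toReal (ENNReal.sub_ne_top ht)]
    exact le_self_add

theorem abs_inv_one_add_sub_le {x y : ℝ} (hx : 0 ≤ x) (hy : 0 ≤ y) :
    |(1 + x)⁻¹ - (1 + y)⁻¹| ≤ |x - y| := by
  have h : (1 + x)⁻¹ - (1 + y)⁻¹ = (y - x) / ((1 + x) * (1 + y)) := by
    field_simp
    ring
  rw [h, abs_div, abs_sub_comm, abs_of_pos (by positivity : 0 < (1 + x) * (1 + y))]
  exact div_le_self (abs_nonneg _) (by nlinarith)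

theorem ofReal_abs_compress_sub_le (t u : ℝ≥0∞) :
    ENNReal.ofReal |compress t - compress u| ≤ (t - u) + (u - t) := by
  by_cases ht : t = ∞
  · by_cases hu : u = ∞
    · simp [ht, hu]
    · simp [ht, hu]
  by_cases hu : u = ∞
  · simp [ht, hu]
  refine le_trans (ENNReal.ofReal_le_ofReal ?_) (ofReal_abs_toReal_sub_le ht hu)
  rw [compress_of_ne_top ht, compress_of_ne_top hu]
  exact abs_inv_one_add_sub_le ENNReal.toReal_nonneg ENNReal.toReal_nonneg

end Compression

section DominatedMeasures

variable {X : Type*} [MeasurableSpace X]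

theorem integral_restrict_eq_mul_integral_cond {σ : Measure X} {A : Set X} (hA : σ A ≠ ∞)
    (F : X → ℝ) :
    ∫ x, F x ∂(σ.restrict A) = (σ A).toReal * ∫ x, F x ∂(ProbabilityTheory.cond σ A) := by
  rw [ProbabilityTheory.cond, integral_smul_measure, ENNReal.toReal_inv, smul_eq_mul, ← mul_assoc]
  by_cases h0 : σ A = 0
  · simp [Measure.restrict_eq_zero.2 h0]
  · rw [mul_inv_cancel₀ (ENNReal.toReal_ne_zero.2 ⟨h0, hA⟩), one_mul]

/-- Replacing `ν` by a smaller measure `τ` costs at most the missing mass times a bound of the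
integrand. -/
theorem lintegral_le_lintegral_add_of_le {τ ν : Measure X} [IsProbabilityMeasure ν] (hle : τ ≤ ν)
    {F : X → ℝ≥0∞} {N : ℝ≥0∞} (hN : ∀ x, F x ≤ N) :
    ∫⁻ x, F x ∂ν ≤ ∫⁻ x, F x ∂τ + N * (1 - τ univ) := by
  have : IsFiniteMeasure τ := ⟨(hle univ).trans_lt (measure_lt_top ν univ)⟩
  have hsub : ν = (ν - τ) + τ := (Measure.sub_add_cancel_of_le hle).symm
  have huniv : (ν - τ) univ = 1 - τ univ := by
    rw [Measure.sub_apply MeasurableSet.univ hle, measure_univ]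
  conv_lhs => rw [hsub]
  rw [lintegral_add_measure, add_comm]
  gcongr
  exact (lintegral_mono hN).trans_eq (by rw [lintegral_const, huniv])

/-- Minorants of `ν` whose masses tend to `1` recover the integrals of all nonnegative functions,
integrable or not. -/
theorem tendsto_lintegral_of_le {ν : Measure X} [IsProbabilityMeasure ν] {τ : ℕ → Measure X}
    (hle : ∀ᶠ k in atTop, τ k ≤ ν) (hτ : Tendsto (fun k => τ k univ) atTop (𝓝 1))
    {F : X → ℝ≥0∞} (hF : Measurable F) :
    Tendsto (fun k => ∫⁻ x, F x ∂(τ k)) atTop (𝓝 (∫⁻ x, F x ∂ν)) := by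
  refine tendsto_of_le_liminf_of_limsup_le ?_ (limsup_le_of_le (by isBoundedDefault) ?_)
  · have h1 : ∀ N : ℕ, ∫⁻ x, min (F x) N ∂ν ≤ liminf (fun k => ∫⁻ x, F x ∂(τ k)) atTop := by
      intro N
      have h2 : Tendsto (fun k => (N : ℝ≥0∞) * (1 - τ k univ)) atTop (𝓝 0) := by
        have := ENNReal.Tendsto.const_mul (a := (N : ℝ≥0∞))
          ((ENNReal.Tendsto.sub tendsto_const_nhds hτ (Or.inl ENNReal.one_ne_top)))
          (Or.inr (ENNReal.natCast_ne_top N))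
        simpa using this
      have hfin : ∫⁻ x, min (F x) N ∂ν ≠ ∞ := by
        refine ((lintegral_mono fun x => min_le_right (F x) (N : ℝ≥0∞)).trans_lt ?_).ne
        simp
      have h3 := ENNReal.Tendsto.sub (tendsto_const_nhds (x := ∫⁻ x, min (F x) N ∂ν)) h2
        (Or.inl hfin)
      rw [tsub_zero] at h3
      rw [← h3.liminf_eq]
      refine liminf_le_liminf ?_
      filter_upwards [hle] with k hk
      refine tsub_le_iff_right.2 ((lintegral_le_lintegral_add_of_le hk
        fun x => min_le_right _ _).trans ?_)
      gcongr
      exact min_le_left _ _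
    have h4 : ∫⁻ x, F x ∂ν = ⨆ N : ℕ, ∫⁻ x, min (F x) N ∂ν := by
      rw [← lintegral_iSup (fun N => hF.min measurable_const)
        fun N M hNM x => min_le_min le_rfl (by exact_mod_cast hNM)]
      refine lintegral_congr fun x => ?_
      refine le_antisymm (le_of_forall_lt fun c hc => ?_) (iSup_le fun N => min_le_left _ _)
      obtain ⟨N, hN⟩ := ENNReal.exists_nat_gt (hc.trans_le le_top).ne
      exact (lt_min hc hN).trans_le (le_iSup (fun N : ℕ => min (F x) (N : ℝ≥0∞)) N)
    rw [h4]
    exact iSup_le h1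
  · filter_upwards [hle] with k hk
    exact lintegral_mono' hk le_rfl

/-- The integral of a real function is controlled by that of a majorant with values in `[0, ∞]`. -/
theorem integral_le_of_ofReal_le {κ : Measure X} {f : X → ℝ} (hf0 : ∀ s, 0 ≤ f s)
    (hf : Measurable f) {g : X → ℝ≥0∞} (hfg : ∀ᵐ s ∂κ, ENNReal.ofReal (f s) ≤ g s) {C : ℝ}
    (hC0 : 0 ≤ C) (hC : ∫⁻ s, g s ∂κ ≤ ENNReal.ofReal C) : ∫ s, f s ∂κ ≤ C := by
  rw [integral_eq_lintegral_of_nonneg_ae (Eventually.of_forall hf0) hf.aestronglyMeasurable]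
  exact ENNReal.toReal_le_of_le_ofReal hC0 ((lintegral_mono_ae hfg).trans hC)

end DominatedMeasures

/-! ### Conditional limits -/

section RatioApprox

variable {X : Type*} [TopologicalSpace X] [MeasurableSpace X]

/-- Two weakly convergent sequences of probability measures `μs n → μ` and `νs n → ν` such that on
each of the sets `H k`, which exhaust them uniformly, `μs n` has the density `z n * hlim` with
respect to `νs n`, and `hlim` is approximated in `L¹` of the conditional laws, uniformly in `n`, by
functions `hr r` which do not depend on `n`, are `ν`-almost everywhere continuous and lie in
`[(a k)⁻¹, a k]` on `H k`. -/
structure IsRatioApprox (μ ν : Measure X) (μs νs : ℕ → Measure X) (H : ℕ → Set X) (a : ℕ → ℝ)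
    (hr : ℕ → X → ℝ≥0∞) (hlim : X → ℝ≥0∞) (z : ℕ → ℝ≥0∞) : Prop where
  isProb_mu : ∀ n, 1 ≤ n → IsProbabilityMeasure (μs n)
  isProb_nu : ∀ n, 1 ≤ n → IsProbabilityMeasure (νs n)
  weakly_mu : WeaklyTendsto μs μ
  weakly_nu : WeaklyTendsto νs ν
  measurableSet : ∀ k, MeasurableSet (H k)
  pos : ∀ k, 0 < a k
  measurable : ∀ r, Measurable (hr r)
  measurable_lim : Measurable hlim
  continuousAt : ∀ r, ∀ᵐ s ∂ν, ContinuousAt (hr r) s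
  le : ∀ k, ∀ s ∈ H k, ∀ r, ENNReal.ofReal (a k)⁻¹ ≤ hr r s
  ge : ∀ k, ∀ s ∈ H k, ∀ r, hr r s ≤ ENNReal.ofReal (a k)
  le_lim : ∀ k n, 1 ≤ n → ∀ᵐ s ∂(νs n), s ∈ H k →
    ENNReal.ofReal (a k)⁻¹ ≤ hlim s ∧ hlim s ≤ ENNReal.ofReal (a k)
  z_ne_top : ∀ n, 1 ≤ n → z n ≠ ∞
  density : ∀ k n, 1 ≤ n →
    (μs n).restrict (H k) = z n • ((νs n).restrict (H k)).withDensity hlim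
  exhaust_mu : Tendsto (fun k => liminf (fun n => μs n (H k)) atTop) atTop (𝓝 1)
  exhaust_nu : Tendsto (fun k => liminf (fun n => νs n (H k)) atTop) atTop (𝓝 1)
  deviation : ∀ k, Tendsto (fun r => ⨆ n : ℕ, ⨆ _ : 1 ≤ n,
    ∫⁻ s, ((hr r s - hlim s) + (hlim s - hr r s)) ∂(ProbabilityTheory.cond (νs n) (H k)))
    atTop (𝓝 0)

namespace IsRatioApprox

variable {μ ν : Measure X} {μs νs : ℕ → Measure X} {H : ℕ → Set X}
  {a : ℕ → ℝ} {hr : ℕ → X → ℝ≥0∞} {hlim : X → ℝ≥0∞} {z : ℕ → ℝ≥0∞}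

theorem ae_cond_mem (S : IsRatioApprox μ ν μs νs H a hr hlim z) (k n : ℕ) :
    ∀ᵐ s ∂(ProbabilityTheory.cond (νs n) (H k)), s ∈ H k :=
  ProbabilityTheory.ae_cond_mem (S.measurableSet k)

theorem eventually_deviation (S : IsRatioApprox μ ν μs νs H a hr hlim z) (k : ℕ) {C : ℝ}
    (hC : 0 < C) : ∀ᶠ r in atTop, ∀ n, 1 ≤ n →
      ∫⁻ s, ((hr r s - hlim s) + (hlim s - hr r s)) ∂(ProbabilityTheory.cond (νs n) (H k)) ≤
        ENNReal.ofReal C := by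
  filter_upwards [(S.deviation k).eventually (gt_mem_nhds (ENNReal.ofReal_pos.2 hC))]
    with r hr' n hn
  exact (le_iSup₂_of_le (f := fun n (_ : 1 ≤ n) => ∫⁻ s, ((hr r s - hlim s) + (hlim s - hr r s))
    ∂(ProbabilityTheory.cond (νs n) (H k))) n hn le_rfl).trans hr'.le

section ConditionalLimit

variable {k : ℕ} {n : ℕ → ℕ} {ρ : Measure X} {α : ℝ≥0∞}

theorem limit_mass_le_one (S : IsRatioApprox μ ν μs νs H a hr hlim z) (hn : StrictMono n)
    (hα : Tendsto (fun p => νs (n p) (H k)) atTop (𝓝 α)) : α ≤ 1 := by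
  refine le_of_tendsto hα ?_
  filter_upwards [eventually_ge_atTop 1] with p hp
  have := S.isProb_nu (n p) (hp.trans (hn.id_le p))
  exact prob_le_one

variable [BorelSpace X] [TopologicalSpace.PseudoMetrizableSpace X] [IsProbabilityMeasure ν]

/-- A conditional limit `ρ` of `νs n ( · | H k)`, weighted by the limit `α` of the masses of `H k`,
is dominated by `ν`. -/
theorem smul_le (S : IsRatioApprox μ ν μs νs H a hr hlim z) (hn : StrictMono n)
    [IsProbabilityMeasure ρ]
    (hα : Tendsto (fun p => νs (n p) (H k)) atTop (𝓝 α))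
    (hρ : WeaklyTendsto (fun p => ProbabilityTheory.cond (νs (n p)) (H k)) ρ) : α • ρ ≤ ν := by
  have hα1 : α ≠ ∞ := ((S.limit_mass_le_one hn hα).trans_lt ENNReal.one_lt_top).ne
  have : IsFiniteMeasure (α • ρ) := Measure.smul_finite ρ hα1
  refine measure_le_of_forall_integral_le fun φ hφ => ?_
  rw [integral_smul_measure, smul_eq_mul]
  refine le_of_tendsto_of_tendsto
    (((ENNReal.tendsto_toReal hα1).comp hα).mul (hρ φ))
    ((S.weakly_nu φ).comp hn.tendsto_atTop) ?_
  filter_upwards [eventually_ge_atTop 1] with p hp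
  have := S.isProb_nu (n p) (hp.trans (hn.id_le p))
  dsimp only [Function.comp]
  rw [← integral_restrict_eq_mul_integral_cond (measure_ne_top _ _)]
  exact integral_mono_measure Measure.restrict_le_self (Eventually.of_forall hφ)
    (φ.integrable _)

theorem absolutelyContinuous (S : IsRatioApprox μ ν μs νs H a hr hlim z) (hn : StrictMono n)
    [IsProbabilityMeasure ρ] (hα0 : 0 < α)
    (hα : Tendsto (fun p => νs (n p) (H k)) atTop (𝓝 α))
    (hρ : WeaklyTendsto (fun p => ProbabilityTheory.cond (νs (n p)) (H k)) ρ) : ρ ≪ ν := by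
  intro A hA
  have h := (S.smul_le hn hα hρ A).trans_eq hA
  simpa [hα0.ne'] using h

/-- The bounds of `h_r` on `H k` pass to its conditional limits, although `H k` need not be
closed. -/
theorem ae_mem_bounds (S : IsRatioApprox μ ν μs νs H a hr hlim z) (hn : StrictMono n)
    [IsProbabilityMeasure ρ] (hα0 : 0 < α)
    (hα : Tendsto (fun p => νs (n p) (H k)) atTop (𝓝 α))
    (hρ : WeaklyTendsto (fun p => ProbabilityTheory.cond (νs (n p)) (H k)) ρ) (r : ℕ) :
    ∀ᵐ s ∂ρ, ENNReal.ofReal (a k)⁻¹ ≤ hr r s ∧ hr r s ≤ ENNReal.ofReal (a k) := by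
  -- a continuous function of `h_r` which vanishes exactly where the bounds hold
  let c : ℝ≥0∞ → ℝ := fun t => max (compress t - compress (ENNReal.ofReal (a k)⁻¹)) 0 +
    max (compress (ENNReal.ofReal (a k)) - compress t) 0
  have hc : Continuous c := by
    have := continuous_compress
    fun_prop
  have hc0 : ∀ t, 0 ≤ c t := fun t => add_nonneg (le_max_right _ _) (le_max_right _ _)
  have hc2 : ∀ t, |c t| ≤ 2 := fun t => by
    rw [abs_of_nonneg (hc0 t)]
    have h1 := compress_le_one t
    have h2 := compress_le_one (ENNReal.ofReal (a k))
    have h3 := compress_nonneg t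
    have h4 := compress_nonneg (ENNReal.ofReal (a k)⁻¹)
    have h5 : max (compress t - compress (ENNReal.ofReal (a k)⁻¹)) 0 ≤ 1 :=
      max_le (by linarith) zero_le_one
    have h6 : max (compress (ENNReal.ofReal (a k)) - compress t) 0 ≤ 1 :=
      max_le (by linarith) zero_le_one
    dsimp only [c]
    linarith
  have hciff : ∀ t, c t = 0 ↔ ENNReal.ofReal (a k)⁻¹ ≤ t ∧ t ≤ ENNReal.ofReal (a k) := fun t => by
    rw [add_eq_zero_iff_of_nonneg (le_max_right _ _) (le_max_right _ _), max_eq_right_iff,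
      max_eq_right_iff, sub_nonpos, sub_nonpos, compress_le_compress_iff, compress_le_compress_iff]
  have hmeas : Measurable fun s => c (hr r s) := hc.measurable.comp (S.measurable r)
  have hlim0 : Tendsto (fun _ : ℕ => (0 : ℝ)) atTop (𝓝 (∫ s, c (hr r s) ∂ρ)) := by
    refine (hρ.tendsto_integral_of_ae_continuousAt hmeas (fun s => hc2 _) ?_).congr fun p => ?_
    · filter_upwards [(S.absolutelyContinuous hn hα0 hα hρ).ae_le (S.continuousAt r)] with s hs
      exact hc.continuousAt.comp hs
    · refine integral_eq_zero_of_ae ?_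
      filter_upwards [S.ae_cond_mem k (n p)] with s hs
      exact (hciff _).2 ⟨S.le k s hs r, S.ge k s hs r⟩
  have h0 := tendsto_nhds_unique hlim0 tendsto_const_nhds
  rw [integral_eq_zero_iff_of_nonneg (fun s => hc0 _)
    (integrable_of_forall_abs_le hmeas.aestronglyMeasurable fun s => hc2 _)] at h0
  filter_upwards [h0] with s hs
  exact (hciff _).1 hs

/-- Since `|h_r - h_r'|` is almost everywhere continuous, the uniform bounds of `|h_r - h|` and
`|h_r' - h|` under the conditional laws pass to the conditional limits. -/
theorem integral_abs_compress_sub_le (S : IsRatioApprox μ ν μs νs H a hr hlim z)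
    (hn : StrictMono n)
    [IsProbabilityMeasure ρ] (hα0 : 0 < α)
    (hα : Tendsto (fun p => νs (n p) (H k)) atTop (𝓝 α))
    (hρ : WeaklyTendsto (fun p => ProbabilityTheory.cond (νs (n p)) (H k)) ρ) {r r' : ℕ} {C : ℝ}
    (hC0 : 0 ≤ C)
    (hC : ∀ n, 1 ≤ n → ∫⁻ s, ((hr r s - hlim s) + (hlim s - hr r s))
      ∂(ProbabilityTheory.cond (νs n) (H k)) ≤ ENNReal.ofReal C)
    (hC' : ∀ n, 1 ≤ n → ∫⁻ s, ((hr r' s - hlim s) + (hlim s - hr r' s))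
      ∂(ProbabilityTheory.cond (νs n) (H k)) ≤ ENNReal.ofReal C) :
    ∫ s, |compress (hr r s) - compress (hr r' s)| ∂ρ ≤ C + C := by
  have hm : ∀ r, Measurable fun s => compress (hr r s) := fun r =>
    continuous_compress.measurable.comp (S.measurable r)
  have hml : Measurable fun s => compress (hlim s) :=
    continuous_compress.measurable.comp S.measurable_lim
  have hb : ∀ t u : ℝ≥0∞, |(|compress t - compress u|)| ≤ 1 := fun t u => by
    rw [abs_abs, abs_le]
    constructor <;>
      linarith [compress_le_one t, compress_le_one u, compress_nonneg t, compress_nonneg u]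
  have hac := S.absolutelyContinuous hn hα0 hα hρ
  refine le_of_tendsto (hρ.tendsto_integral_of_ae_continuousAt
    (F := fun s => |compress (hr r s) - compress (hr r' s)|) ((hm r).sub (hm r')).abs
    (fun s => hb _ _) ?_) ?_
  · filter_upwards [hac.ae_le (S.continuousAt r), hac.ae_le (S.continuousAt r')] with s h1 h2
    exact ((continuous_compress.continuousAt.comp h1).sub
      (continuous_compress.continuousAt.comp h2)).abs
  · filter_upwards [eventually_ge_atTop 1] with p hp
    have hnp : 1 ≤ n p := hp.trans (hn.id_le p)
    have key : ∀ r, (∀ n, 1 ≤ n → ∫⁻ s, ((hr r s - hlim s) + (hlim s - hr r s))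
        ∂(ProbabilityTheory.cond (νs n) (H k)) ≤ ENNReal.ofReal C) →
        ∫ s, |compress (hr r s) - compress (hlim s)|
          ∂(ProbabilityTheory.cond (νs (n p)) (H k)) ≤ C := fun r h =>
      integral_le_of_ofReal_le (fun s => abs_nonneg _) ((hm r).sub hml).abs
        (Eventually.of_forall fun s => ofReal_abs_compress_sub_le _ _) hC0 (h _ hnp)
    have hi : ∀ r, Integrable (fun s => |compress (hr r s) - compress (hlim s)|)
        (ProbabilityTheory.cond (νs (n p)) (H k)) := fun r =>
      integrable_of_forall_abs_le ((hm r).sub hml).abs.aestronglyMeasurable fun s => hb _ _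
    refine le_trans ?_ (add_le_add (key r hC) (key r' hC'))
    rw [← integral_add (hi r) (hi r')]
    refine integral_mono (integrable_of_forall_abs_le
      ((hm r).sub (hm r')).abs.aestronglyMeasurable fun s => hb _ _) ((hi r).add (hi r'))
      fun s => ?_
    exact (abs_sub_le _ (compress (hlim s)) _).trans_eq (by rw [abs_sub_comm (compress (hlim s))])

end ConditionalLimit

/-- The subsequential limits of the conditional laws exist. -/
theorem exists_conditionalLimit [BorelSpace X] [TopologicalSpace.PseudoMetrizableSpace X]
    [SecondCountableTopology X] [IsProbabilityMeasure ν]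
    (S : IsRatioApprox μ ν μs νs H a hr hlim z) {k₀ : ℕ}
    (hk₀ : ∀ k, k₀ ≤ k → 0 < liminf (fun n => νs n (H k)) atTop)
    {N : ℕ → ℕ} (hN : Tendsto N atTop atTop) :
    ∃ (θ : ℕ → ℕ) (νlim : ℕ → Measure X), StrictMono θ ∧ ∀ k, k₀ ≤ k →
      IsConditionalLimit νs (H k) (fun p => N (θ p)) (νlim k) := by
  obtain ⟨θ₁, hθ₁, hNθ₁⟩ := strictMono_subseq_of_tendsto_atTop hN
  -- the index `0` carries no hypothesis, hence the shift by one
  have hprob : ∀ p, IsProbabilityMeasure (νs (N (θ₁ (p + 1)))) := fun p =>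
    S.isProb_nu _ ((Nat.le_add_left 1 p).trans (hNθ₁.id_le _))
  have hmono : StrictMono fun p => N (θ₁ (p + 1)) := fun p q hpq =>
    hNθ₁ (Nat.add_lt_add_right hpq 1)
  obtain ⟨θ₂, hθ₂, hlimθ⟩ := exists_subseq_weaklyTendsto_restrict
    (σ := fun p => νs (N (θ₁ (p + 1)))) (ν := ν)
    (fun φ => (S.weakly_nu φ).comp hmono.tendsto_atTop) H
  choose τ hτfin hτ using hlimθ
  have hm : StrictMono fun p => N (θ₁ (θ₂ p + 1)) := hmono.comp hθ₂
  refine ⟨fun p => θ₁ (θ₂ p + 1), fun k => (τ k univ)⁻¹ • τ k,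
    fun p q hpq => hθ₁ (Nat.add_lt_add_right (hθ₂ hpq) 1), fun k hk => ?_⟩
  have hmass : Tendsto (fun p => νs (N (θ₁ (θ₂ p + 1))) (H k)) atTop (𝓝 (τ k univ)) := by
    have h1 := hτ k (BoundedContinuousFunction.const X 1)
    simp only [BoundedContinuousFunction.const_apply, integral_const, smul_eq_mul, mul_one,
      measureReal_def, Measure.restrict_apply_univ] at h1
    rwa [ENNReal.tendsto_toReal_iff (fun p => ?_) (measure_ne_top _ _)] at h1
    have := hprob (θ₂ p)
    exact measure_ne_top _ _
  have hpos : 0 < τ k univ := by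
    refine (hk₀ k hk).trans_le ?_
    rw [← hmass.liminf_eq]
    exact hm.tendsto_atTop.liminf_le_liminf_comp
  refine ⟨hm, ⟨?_⟩, ⟨_, hpos, hmass⟩, fun φ => ?_⟩
  · rw [Measure.smul_apply, smul_eq_mul, ENNReal.inv_mul_cancel hpos.ne' (measure_ne_top _ _)]
  · simp only [ProbabilityTheory.cond, integral_smul_measure]
    refine Tendsto.smul ?_ (hτ k φ)
    refine (ENNReal.tendsto_toReal (by simpa using hpos.ne')).comp ?_
    exact tendsto_inv_iff.2 hmass

end IsRatioApprox

end RatioApprox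

/-! ### The limit of `h_r` in `L¹` of the conditional limits -/

section RatioLimit

variable {X : Type*} [MeasurableSpace X]

theorem integral_le_integral_add_of_smul_le {ρ ν : Measure X} [IsProbabilityMeasure ρ]
    [IsProbabilityMeasure ν] {α : ℝ≥0∞} (hle : α • ρ ≤ ν) {F : X → ℝ} (hF : Measurable F)
    (h0 : ∀ s, 0 ≤ F s) (h1 : ∀ s, F s ≤ 1) :
    ∫ s, F s ∂ν ≤ ∫ s, F s ∂ρ + (1 - α.toReal) := by
  have hα : α ≤ 1 := by simpa using hle univ
  have hα' : α.toReal ≤ 1 := ENNReal.toReal_le_of_le_ofReal zero_le_one (by simpa using hα)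
  have hi : ∀ (κ : Measure X) [IsProbabilityMeasure κ], Integrable F κ := fun κ _ =>
    integrable_of_forall_abs_le hF.aestronglyMeasurable (C := 1) fun s => by
      rw [abs_of_nonneg (h0 s)]; exact h1 s
  have h2 := integral_mono_measure hle (f := fun s => 1 - F s)
    (Eventually.of_forall fun s => sub_nonneg.2 (h1 s)) ((integrable_const 1).sub (hi ν))
  rw [integral_smul_measure, integral_sub (integrable_const 1) (hi ν),
    integral_sub (integrable_const 1) (hi ρ)] at h2
  simp only [integral_const, probReal_univ, smul_eq_mul, mul_one] at h2
  have h3 : 0 ≤ ∫ s, F s ∂ρ := integral_nonneg h0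
  nlinarith [mul_nonneg (sub_nonneg.2 hα') h3]

theorem integral_le_inv_mul_of_smul_le {ρ ν : Measure X} {α : ℝ≥0∞} (hα0 : 0 < α) (hα : α ≠ ∞)
    (hle : α • ρ ≤ ν) {F : X → ℝ} (h0 : ∀ s, 0 ≤ F s) (hF : Integrable F ν) :
    ∫ s, F s ∂ρ ≤ α.toReal⁻¹ * ∫ s, F s ∂ν := by
  have h2 := integral_mono_measure hle (Eventually.of_forall h0) hF
  rw [integral_smul_measure, smul_eq_mul] at h2
  rwa [← div_eq_inv_mul, le_div_iff₀' (ENNReal.toReal_pos hα0.ne' hα)]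

theorem integrable_of_smul_le {ρ ν : Measure X} {α : ℝ≥0∞} (hα0 : 0 < α) (hα : α ≠ ∞)
    (hle : α • ρ ≤ ν) {F : X → ℝ} (hF : Integrable F ν) : Integrable F ρ :=
  (integrable_smul_measure hα0.ne' hα).1 (hF.mono_measure hle)

/-- Completeness of `L¹`, stated for functions. -/
theorem exists_tendsto_integral_abs_sub_of_cauchy {ν : Measure X} [IsProbabilityMeasure ν]
    {g : ℕ → X → ℝ} (hg : ∀ r, Integrable (g r) ν)
    (hc : ∀ ε > 0, ∃ N, ∀ r, N ≤ r → ∀ r', N ≤ r' → ∫ s, |g r s - g r' s| ∂ν < ε) :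
    ∃ G : X → ℝ, Measurable G ∧ Integrable G ν ∧
      Tendsto (fun r => ∫ s, |g r s - G s| ∂ν) atTop (𝓝 0) := by
  have hdist : ∀ {f f' : X → ℝ} (hf : Integrable f ν) (hf' : Integrable f' ν),
      dist (hf.toL1 f) (hf'.toL1 f') = ∫ s, |f s - f' s| ∂ν := by
    intro f f' hf hf'
    rw [dist_eq_norm, ← Integrable.toL1_sub, L1.norm_eq_integral_norm]
    refine integral_congr_ae ?_
    filter_upwards [(hf.sub hf').coeFn_toL1] with s hs
    rw [hs, Real.norm_eq_abs, Pi.sub_apply]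
  have hcau : CauchySeq fun r => (hg r).toL1 (g r) := by
    refine Metric.cauchySeq_iff.2 fun ε hε => ?_
    obtain ⟨N, hN⟩ := hc ε hε
    exact ⟨N, fun r hr r' hr' => (hdist (hg r) (hg r')).trans_lt (hN r hr r' hr')⟩
  obtain ⟨G, hG⟩ := cauchySeq_tendsto_of_complete hcau
  refine ⟨G, (Lp.stronglyMeasurable G).measurable, L1.integrable_coeFn G, ?_⟩
  refine (tendsto_iff_dist_tendsto_zero.1 hG).congr fun r => ?_
  rw [← hdist (hg r) (L1.integrable_coeFn G), Integrable.toL1_coeFn]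

/-- The inverse `u ↦ 1 / u - 1` of `compress` is Lipschitz away from `0`. -/
theorem abs_sub_inv_compress_le {t : ℝ≥0∞} (ht : t ≠ ∞) {c g : ℝ} (hc : 0 < c)
    (hct : c ≤ compress t) (hcg : c ≤ g) :
    |t.toReal - max (g⁻¹ - 1) 0| ≤ (c ^ 2)⁻¹ * |compress t - g| := by
  have ht0 : 0 ≤ t.toReal := ENNReal.toReal_nonneg
  have hg : 0 < g := hc.trans_le hcg
  have hu : 0 < compress t := hc.trans_le hct
  have h1 : |t.toReal - max (g⁻¹ - 1) 0| ≤ |t.toReal - (g⁻¹ - 1)| := by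
    conv_lhs => rw [← max_eq_left ht0]
    exact abs_max_sub_max_le_abs _ _ _
  have h2 : t.toReal = (compress t)⁻¹ - 1 := by
    rw [compress_of_ne_top ht, inv_inv]
    ring
  have h3 : t.toReal - (g⁻¹ - 1) = (g - compress t) / (compress t * g) := by
    rw [h2]
    field_simp
    ring
  refine h1.trans ?_
  rw [h3, abs_div, abs_sub_comm, abs_of_pos (mul_pos hu hg), div_eq_inv_mul]
  gcongr
  nlinarith

namespace IsRatioApprox

variable [TopologicalSpace X] [BorelSpace X] [TopologicalSpace.PseudoMetrizableSpace X]

variable {μ ν : Measure X} [IsProbabilityMeasure ν] {μs νs : ℕ → Measure X} {H : ℕ → Set X}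
  {a : ℕ → ℝ} {hr : ℕ → X → ℝ≥0∞} {hlim : X → ℝ≥0∞} {z : ℕ → ℝ≥0∞}

omit [BorelSpace X] [TopologicalSpace.PseudoMetrizableSpace X] [IsProbabilityMeasure ν] in
theorem tendsto_limit_mass (S : IsRatioApprox μ ν μs νs H a hr hlim z) {n : ℕ → ℕ}
    (hn : StrictMono n)
    {k₀ : ℕ} {α : ℕ → ℝ≥0∞}
    (hα : ∀ k, k₀ ≤ k → Tendsto (fun p => νs (n p) (H k)) atTop (𝓝 (α k))) :
    Tendsto α atTop (𝓝 1) := by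
  refine tendsto_of_tendsto_of_tendsto_of_le_of_le' S.exhaust_nu tendsto_const_nhds ?_ ?_
  · filter_upwards [eventually_ge_atTop k₀] with k hk
    rw [← (hα k hk).liminf_eq]
    exact hn.tendsto_atTop.liminf_le_liminf_comp
  · filter_upwards [eventually_ge_atTop k₀] with k hk
    exact S.limit_mass_le_one hn (hα k hk)

/-- Along conditional limits whose masses tend to `1`, the functions `1 / (1 + h_r)` form a Cauchy
sequence in `L¹(ν)`. -/
theorem exists_limit_compress (S : IsRatioApprox μ ν μs νs H a hr hlim z) {n : ℕ → ℕ}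
    {νlim : ℕ → Measure X} {k₀ : ℕ}
    (hcl : ∀ k, k₀ ≤ k → IsConditionalLimit νs (H k) n (νlim k)) :
    ∃ G : X → ℝ, Measurable G ∧ Integrable G ν ∧
      Tendsto (fun r => ∫ s, |compress (hr r s) - G s| ∂ν) atTop (𝓝 0) := by
  have hm : ∀ r, Measurable fun s => compress (hr r s) := fun r =>
    continuous_compress.measurable.comp (S.measurable r)
  refine exists_tendsto_integral_abs_sub_of_cauchy (fun r => integrable_of_forall_abs_le
    (hm r).aestronglyMeasurable fun s => abs_compress_le_one _) fun ε hε => ?_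
  have hn : StrictMono n := (hcl k₀ le_rfl).1
  choose! α hα0 hα using fun k hk => (hcl k hk).2.2.1
  have h1 := (ENNReal.tendsto_toReal ENNReal.one_ne_top).comp (S.tendsto_limit_mass hn hα)
  rw [ENNReal.toReal_one] at h1
  obtain ⟨k, hk1, hk⟩ := ((h1.eventually (lt_mem_nhds (by linarith : 1 - ε / 2 < 1))).and
    (eventually_ge_atTop k₀)).exists
  have hprob := (hcl k hk).2.1
  obtain ⟨N, hN⟩ := eventually_atTop.1 (S.eventually_deviation k (by positivity : 0 < ε / 4))
  refine ⟨N, fun r hNr r' hNr' => ?_⟩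
  have h2 := S.integral_abs_compress_sub_le hn (hα0 k hk) (hα k hk) (hcl k hk).2.2.2
    (by positivity) (hN r hNr) (hN r' hNr')
  have h3 := integral_le_integral_add_of_smul_le (S.smul_le hn (hα k hk) (hcl k hk).2.2.2)
    (((hm r).sub (hm r')).abs) (fun s => abs_nonneg _) fun s => abs_le.2 (by
      simp only [Pi.sub_apply]
      constructor <;> linarith [compress_le_one (hr r s), compress_le_one (hr r' s),
        compress_nonneg (hr r s), compress_nonneg (hr r' s)])
  refine h3.trans_lt ?_
  dsimp only [Function.comp] at hk1
  simp only [Pi.sub_apply]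
  linarith

/-- The `L¹(ν)`-limit of `1 / (1 + h_r)` determines the limit of `h_r` itself, strongly in `L¹` of
every conditional limit, where the `h_r` are bounded. -/
theorem tendsto_integral_abs_sub (S : IsRatioApprox μ ν μs νs H a hr hlim z) {G : X → ℝ}
    (hGi : Integrable G ν)
    (hG : Tendsto (fun r => ∫ s, |compress (hr r s) - G s| ∂ν) atTop (𝓝 0))
    {k : ℕ} {n : ℕ → ℕ} {ρ : Measure X} (hcl : IsConditionalLimit νs (H k) n ρ) :
    (∀ᵐ s ∂ρ, max ((G s)⁻¹ - 1) 0 ≤ a k) ∧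
      Tendsto (fun r => ∫ s, |(hr r s).toReal - max ((G s)⁻¹ - 1) 0| ∂ρ) atTop (𝓝 0) := by
  obtain ⟨hn, hprob, ⟨α, hα0, hα⟩, hρ⟩ := hcl
  have hαtop : α ≠ ∞ := ((S.limit_mass_le_one hn hα).trans_lt ENNReal.one_lt_top).ne
  have hle := S.smul_le hn hα hρ
  have hm : ∀ r, Measurable fun s => compress (hr r s) := fun r =>
    continuous_compress.measurable.comp (S.measurable r)
  have hi : ∀ r, Integrable (fun s => |compress (hr r s) - G s|) ν := fun r =>
    ((integrable_of_forall_abs_le (hm r).aestronglyMeasurable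
      fun s => abs_compress_le_one _).sub hGi).abs
  have hiρ := fun r => integrable_of_smul_le hα0 hαtop hle (hi r)
  have hGρ : Tendsto (fun r => ∫ s, |compress (hr r s) - G s| ∂ρ) atTop (𝓝 0) := by
    refine squeeze_zero (fun r => integral_nonneg fun s => abs_nonneg _)
      (fun r => integral_le_inv_mul_of_smul_le hα0 hαtop hle (fun s => abs_nonneg _) (hi r)) ?_
    simpa using hG.const_mul α.toReal⁻¹
  have ha : 0 < a k := S.pos k
  set c : ℝ := (1 + a k)⁻¹ with hc
  have hc0 : 0 < c := by positivity
  have hbd : ∀ r, ∀ᵐ s ∂ρ, hr r s ≠ ∞ ∧ c ≤ compress (hr r s) := fun r => by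
    filter_upwards [S.ae_mem_bounds hn hα0 hα hρ r] with s hs
    refine ⟨(hs.2.trans_lt ENNReal.ofReal_lt_top).ne, ?_⟩
    rw [hc, ← compress_ofReal ha.le, compress_le_compress_iff]
    exact hs.2
  have hcG : ∀ᵐ s ∂ρ, c ≤ G s := by
    have hint : Integrable (fun s => max (c - G s) 0) ρ :=
      ((integrable_const c).sub (integrable_of_smul_le hα0 hαtop hle hGi)).pos_part
    have h0 : ∫ s, max (c - G s) 0 ∂ρ ≤ 0 := by
      refine ge_of_tendsto' hGρ fun r => integral_mono_ae hint (hiρ r) ?_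
      filter_upwards [hbd r] with s hs
      exact max_le ((sub_le_sub_right hs.2 _).trans (le_abs_self _)) (abs_nonneg _)
    have h1 := (integral_eq_zero_iff_of_nonneg (fun s => le_max_right _ _) hint).1
      (h0.antisymm (integral_nonneg fun s => le_max_right _ _))
    filter_upwards [h1] with s hs
    simpa using hs
  refine ⟨?_, ?_⟩
  · filter_upwards [hcG] with s hs
    refine max_le ?_ ha.le
    have : (G s)⁻¹ ≤ c⁻¹ := inv_anti₀ hc0 hs
    rw [hc, inv_inv] at this
    linarith
  · have hz : Tendsto (fun r => (c ^ 2)⁻¹ * ∫ s, |compress (hr r s) - G s| ∂ρ) atTop (𝓝 0) := by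
      simpa using hGρ.const_mul (c ^ 2)⁻¹
    refine squeeze_zero (fun r => integral_nonneg fun s => abs_nonneg _) (fun r => ?_) hz
    rw [← integral_const_mul]
    refine integral_mono_of_nonneg (Eventually.of_forall fun s => abs_nonneg _)
      ((hiρ r).const_mul _) ?_
    filter_upwards [hbd r, hcG] with s h1 h2
    exact abs_sub_inv_compress_le h1.1 hc0 h1.2 h2

theorem weakL1Limit (S : IsRatioApprox μ ν μs νs H a hr hlim z) {g : X → ℝ} (hg : Measurable g)
    (hg0 : ∀ s, 0 ≤ g s)
    {k : ℕ} {n : ℕ → ℕ} {ρ : Measure X} (hcl : IsConditionalLimit νs (H k) n ρ)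
    (hga : ∀ᵐ s ∂ρ, g s ≤ a k)
    (hlimg : Tendsto (fun r => ∫ s, |(hr r s).toReal - g s| ∂ρ) atTop (𝓝 0)) :
    WeakL1Limit ρ hr g := by
  obtain ⟨hn, hprob, ⟨α, hα0, hα⟩, hρ⟩ := hcl
  have hb := S.ae_mem_bounds hn hα0 hα hρ
  have hgi : Integrable g ρ := Integrable.of_bound hg.aestronglyMeasurable (a k) <| by
    filter_upwards [hga] with s hs
    rwa [Real.norm_of_nonneg (hg0 s)]
  have hri : ∀ r, Integrable (fun s => (hr r s).toReal) ρ := fun r =>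
    Integrable.of_bound (S.measurable r).ennreal_toReal.aestronglyMeasurable (a k) <| by
      filter_upwards [hb r] with s hs
      rw [Real.norm_of_nonneg ENNReal.toReal_nonneg]
      exact ENNReal.toReal_le_of_le_ofReal (S.pos k).le hs.2
  refine ⟨fun r => ⟨(S.measurable r).aemeasurable, ?_⟩, hgi, fun φ hφ => ?_⟩
  · refine (lintegral_mono_ae (hb r |>.mono fun s hs => hs.2)).trans_lt ?_
    simp
  · obtain ⟨M, hM⟩ : ∃ M : ℝ, ∀ᵐ s ∂ρ, ‖φ s‖ ≤ M := by
      refine ⟨(eLpNormEssSup φ ρ).toReal, ?_⟩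
      have h1 : eLpNormEssSup φ ρ ≠ ∞ := by simpa using hφ.2.ne
      filter_upwards [ae_le_eLpNormEssSup (f := φ) (μ := ρ)] with s hs
      rw [← toReal_enorm]
      exact ENNReal.toReal_mono h1 hs
    have hM' : ∀ {u : X → ℝ}, Integrable u ρ → Integrable (fun s => φ s * u s) ρ := fun hu =>
      hu.bdd_mul hφ.1 hM
    rw [tendsto_iff_dist_tendsto_zero]
    refine squeeze_zero (fun r => dist_nonneg) (fun r => ?_)
      (by simpa using hlimg.const_mul M)
    rw [Real.dist_eq, ← integral_sub (hM' (hri r)) (hM' hgi), ← integral_const_mul]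
    refine abs_integral_le_integral_abs.trans (integral_mono_of_nonneg
      (Eventually.of_forall fun s => abs_nonneg _) (((hri r).sub hgi).abs.const_mul M) ?_)
    filter_upwards [hM] with s hs
    rw [← mul_sub, abs_mul]
    exact mul_le_mul_of_nonneg_right hs (abs_nonneg _)

/-- The weighted conditional limits exhaust `ν` as `k → ∞`. -/
theorem tendsto_mul_lintegral (S : IsRatioApprox μ ν μs νs H a hr hlim z) {n : ℕ → ℕ}
    (hn : StrictMono n) {νlim : ℕ → Measure X} {k₀ : ℕ} {α : ℕ → ℝ≥0∞}
    (hprob : ∀ k, k₀ ≤ k → IsProbabilityMeasure (νlim k))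
    (hα : ∀ k, k₀ ≤ k → Tendsto (fun p => νs (n p) (H k)) atTop (𝓝 (α k)))
    (hρ : ∀ k, k₀ ≤ k →
      WeaklyTendsto (fun p => ProbabilityTheory.cond (νs (n p)) (H k)) (νlim k))
    {F : X → ℝ≥0∞} (hF : Measurable F) :
    Tendsto (fun k => α k * ∫⁻ s, F s ∂(νlim k)) atTop (𝓝 (∫⁻ s, F s ∂ν)) := by
  have h := tendsto_lintegral_of_le (ν := ν) (τ := fun k => α k • νlim k) ?_ ?_ hF
  · simpa only [lintegral_smul_measure, smul_eq_mul] using h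
  · filter_upwards [eventually_ge_atTop k₀] with k hk
    have := hprob k hk
    exact S.smul_le hn (hα k hk) (hρ k hk)
  · refine (S.tendsto_limit_mass hn hα).congr' ?_
    filter_upwards [eventually_ge_atTop k₀] with k hk
    have := hprob k hk
    simp

/-- Weak limits in `L¹` of all the conditional limits determine a function `ν`-almost everywhere. -/
theorem ae_eq_of_weakL1Limit (S : IsRatioApprox μ ν μs νs H a hr hlim z) {n : ℕ → ℕ}
    {νlim : ℕ → Measure X} {k₀ : ℕ}
    (hcl : ∀ k, k₀ ≤ k → IsConditionalLimit νs (H k) n (νlim k)) {g g' : X → ℝ}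
    (hg : Integrable g ν) (hg' : Integrable g' ν)
    (h : ∀ k, k₀ ≤ k → WeakL1Limit (νlim k) hr g) (h' : ∀ k, k₀ ≤ k → WeakL1Limit (νlim k) hr g') :
    g =ᵐ[ν] g' := by
  have hn : StrictMono n := (hcl k₀ le_rfl).1
  choose! α hα0 hα using fun k hk => (hcl k hk).2.2.1
  have hαtop : ∀ k, k₀ ≤ k → α k ≠ ∞ := fun k hk =>
    ((S.limit_mass_le_one hn (hα k hk)).trans_lt ENNReal.one_lt_top).ne
  have heq : ∀ k, k₀ ≤ k → g =ᵐ[νlim k] g' := by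
    intro k hk
    have hprob := (hcl k hk).2.1
    refine (h k hk).2.1.ae_eq_of_forall_setIntegral_eq _ _ (h' k hk).2.1 fun A hA _ => ?_
    have hφ : MemLp (A.indicator fun _ => (1 : ℝ)) ∞ (νlim k) :=
      memLp_indicator_const ∞ hA 1 (Or.inr (measure_ne_top _ _))
    have h1 := tendsto_nhds_unique ((h k hk).2.2 _ hφ) ((h' k hk).2.2 _ hφ)
    simpa [← indicator_mul_left, integral_indicator hA] using h1
  -- `g` and `g'` are only almost everywhere measurable, so their measurable versions are compared
  let B : Set X := {s | hg.1.mk g s ≠ hg'.1.mk g' s}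
  have hB : MeasurableSet B :=
    (measurableSet_eq_fun hg.1.stronglyMeasurable_mk.measurable
      hg'.1.stronglyMeasurable_mk.measurable).compl
  have hB0 : ∀ k, k₀ ≤ k → νlim k B = 0 := by
    intro k hk
    have hprob := (hcl k hk).2.1
    have hac := S.absolutelyContinuous hn (hα0 k hk) (hα k hk) (hcl k hk).2.2.2
    have : ∀ᵐ s ∂(νlim k), hg.1.mk g s = hg'.1.mk g' s := by
      filter_upwards [heq k hk, hac.ae_le hg.1.ae_eq_mk, hac.ae_le hg'.1.ae_eq_mk] with s h1 h2 h3
      rw [← h2, ← h3, h1]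
    exact this
  have h1 := S.tendsto_mul_lintegral hn (fun k hk => (hcl k hk).2.1) hα
    (fun k hk => (hcl k hk).2.2.2) (F := B.indicator 1) (measurable_one.indicator hB)
  have h2 : ν B = 0 := by
    rw [lintegral_indicator_one hB] at h1
    refine tendsto_nhds_unique (h1.congr' ?_) tendsto_const_nhds
    filter_upwards [eventually_ge_atTop k₀] with k hk
    rw [lintegral_indicator_one hB, hB0 k hk, mul_zero]
  have h3 : ∀ᵐ s ∂ν, hg.1.mk g s = hg'.1.mk g' s := h2
  filter_upwards [h3, hg.1.ae_eq_mk, hg'.1.ae_eq_mk] with s h4 h5 h6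
  rw [h5, h6, h4]

end IsRatioApprox

end RatioLimit

/-! ### The density of `μ` with respect to `ν` -/

section RatioDensity

variable {X : Type*} [TopologicalSpace X] [MeasurableSpace X]

theorem IsConditionalLimit.comp {ρs : ℕ → Measure X} {A : Set X} {n : ℕ → ℕ} {ρ : Measure X}
    (h : IsConditionalLimit ρs A n ρ) {θ : ℕ → ℕ} (hθ : StrictMono θ) :
    IsConditionalLimit ρs A (fun p => n (θ p)) ρ := by
  obtain ⟨hn, hprob, ⟨α, hα0, hα⟩, hρ⟩ := h
  exact ⟨hn.comp hθ, hprob, ⟨α, hα0, hα.comp hθ.tendsto_atTop⟩,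
    fun φ => (hρ φ).comp hθ.tendsto_atTop⟩

namespace IsRatioApprox

variable {μ ν : Measure X} {μs νs : ℕ → Measure X} {H : ℕ → Set X}
  {a : ℕ → ℝ} {hr : ℕ → X → ℝ≥0∞} {hlim : X → ℝ≥0∞} {z : ℕ → ℝ≥0∞}

theorem integral_restrict_eq (S : IsRatioApprox μ ν μs νs H a hr hlim z) (k : ℕ) {n : ℕ}
    (hn : 1 ≤ n) (F : X → ℝ) :
    ∫ s, F s ∂((μs n).restrict (H k)) = (z n).toReal * ((νs n (H k)).toReal *
      ∫ s, F s * (hlim s).toReal ∂(ProbabilityTheory.cond (νs n) (H k))) := by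
  have := S.isProb_nu n hn
  rw [S.density k n hn, integral_smul_measure, smul_eq_mul,
    ← integral_restrict_eq_mul_integral_cond (measure_ne_top _ _),
    integral_withDensity_eq_integral_toReal_smul S.measurable_lim]
  · congr 1
    exact integral_congr_ae (Eventually.of_forall fun s => by simp [mul_comm])
  · rw [ae_restrict_iff' (S.measurableSet k)]
    filter_upwards [S.le_lim k n hn] with s hs hsH
    exact (hs hsH).2.trans_lt ENNReal.ofReal_lt_top

/-- The total mass lost outside `H k` and the replacement of `h` by `h_r` are the two errors made
when `μs n` is compared with `z n * h_r` times the conditional law. -/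
theorem abs_integral_sub_le [OpensMeasurableSpace X]
    (S : IsRatioApprox μ ν μs νs H a hr hlim z) {k n r : ℕ}
    (hn : 1 ≤ n) (φ : X →ᵇ ℝ) {C : ℝ} (hC0 : 0 ≤ C)
    (hC : ∫⁻ s, ((hr r s - hlim s) + (hlim s - hr r s)) ∂(ProbabilityTheory.cond (νs n) (H k)) ≤
      ENNReal.ofReal C) :
    |∫ s, φ s ∂(μs n) - (z n).toReal * ((νs n (H k)).toReal *
      ∫ s, φ s * (min (hr r s) (ENNReal.ofReal (a k))).toReal
        ∂(ProbabilityTheory.cond (νs n) (H k)))| ≤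
      ‖φ‖ * ((1 - (μs n (H k)).toReal) + (z n).toReal * C) := by
  have hpμ := S.isProb_mu n hn
  have hpν := S.isProb_nu n hn
  set κ := ProbabilityTheory.cond (νs n) (H k) with hκ
  have hcut : ∀ r, Measurable fun s => (min (hr r s) (ENNReal.ofReal (a k))).toReal := fun r =>
    ((S.measurable r).min measurable_const).ennreal_toReal
  have hH : ∀ᵐ s ∂κ, s ∈ H k := S.ae_cond_mem k n
  have hlimκ : ∀ᵐ s ∂κ, ENNReal.ofReal (a k)⁻¹ ≤ hlim s ∧ hlim s ≤ ENNReal.ofReal (a k) := by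
    have : κ ≪ νs n := ProbabilityTheory.cond_absolutelyContinuous
    filter_upwards [hH, this.ae_le (S.le_lim k n hn)] with s h1 h2
    exact h2 h1
  have hi1 : Integrable (fun s => (hlim s).toReal) κ :=
    Integrable.of_bound S.measurable_lim.ennreal_toReal.aestronglyMeasurable (a k) <| by
      filter_upwards [hlimκ] with s hs
      rw [Real.norm_of_nonneg ENNReal.toReal_nonneg]
      exact ENNReal.toReal_le_of_le_ofReal (S.pos k).le hs.2
  have hi2 : Integrable (fun s => (min (hr r s) (ENNReal.ofReal (a k))).toReal) κ :=
    integrable_of_forall_abs_le (hcut r).aestronglyMeasurable fun s => by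
      rw [abs_of_nonneg ENNReal.toReal_nonneg]
      exact ENNReal.toReal_le_of_le_ofReal (S.pos k).le (min_le_right _ _)
  have hmul : ∀ {u : X → ℝ}, Integrable u κ → Integrable (fun s => φ s * u s) κ := fun hu =>
    hu.bdd_mul φ.continuous.aestronglyMeasurable
      (Eventually.of_forall fun x => φ.norm_coe_le_norm x)
  have hdiff : |∫ s, φ s * (hlim s).toReal ∂κ -
      ∫ s, φ s * (min (hr r s) (ENNReal.ofReal (a k))).toReal ∂κ| ≤ ‖φ‖ * C := by
    rw [← integral_sub (hmul hi1) (hmul hi2)]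
    refine abs_integral_le_integral_abs.trans (le_trans (integral_mono_of_nonneg
      (Eventually.of_forall fun s => abs_nonneg _) ((hi1.sub hi2).abs.const_mul ‖φ‖)
      (Eventually.of_forall fun s => ?_)) ?_)
    · dsimp only [Pi.sub_apply]
      rw [← mul_sub, abs_mul]
      exact mul_le_mul_of_nonneg_right (φ.norm_coe_le_norm s) (abs_nonneg _)
    · rw [integral_const_mul]
      refine mul_le_mul_of_nonneg_left (integral_le_of_ofReal_le (fun s => abs_nonneg _)
        (S.measurable_lim.ennreal_toReal.sub (hcut r)).abs ?_ hC0 hC) (norm_nonneg _)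
      filter_upwards [hH, hlimκ] with s h1 h2
      have h3 := S.ge k s h1 r
      have h4 := ofReal_abs_toReal_sub_le (h3.trans_lt ENNReal.ofReal_lt_top).ne
        (h2.2.trans_lt ENNReal.ofReal_lt_top).ne
      simp only [Pi.sub_apply]
      rwa [min_eq_left h3, abs_sub_comm]
  have hout : |∫ s, φ s ∂(μs n) - ∫ s, φ s ∂((μs n).restrict (H k))| ≤
      ‖φ‖ * (1 - (μs n (H k)).toReal) := by
    have h1 := integral_add_compl (S.measurableSet k) (φ.integrable (μs n))
    have h2 : ∫ s, φ s ∂(μs n) - ∫ s, φ s ∂((μs n).restrict (H k)) =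
        ∫ s in (H k)ᶜ, φ s ∂(μs n) := by
      linarith
    rw [h2]
    refine (norm_setIntegral_le_of_norm_le_const (measure_lt_top _ _)
      (fun s _ => φ.norm_coe_le_norm s)).trans_eq ?_
    rw [probReal_compl_eq_one_sub (S.measurableSet k)]
    rfl
  have hz0 : 0 ≤ (z n).toReal := ENNReal.toReal_nonneg
  have hν1 : (νs n (H k)).toReal ≤ 1 :=
    ENNReal.toReal_le_of_le_ofReal zero_le_one (by simpa using prob_le_one)
  have hν0 : 0 ≤ (νs n (H k)).toReal := ENNReal.toReal_nonneg
  rw [S.integral_restrict_eq k hn] at hout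
  refine (abs_sub_le _ ((z n).toReal * ((νs n (H k)).toReal *
    ∫ s, φ s * (hlim s).toReal ∂κ)) _).trans ?_
  rw [← mul_sub, ← mul_sub, abs_mul, abs_mul, abs_of_nonneg hz0, abs_of_nonneg hν0]
  have h5 : (νs n (H k)).toReal * |∫ s, φ s * (hlim s).toReal ∂κ -
      ∫ s, φ s * (min (hr r s) (ENNReal.ofReal (a k))).toReal ∂κ| ≤ ‖φ‖ * C :=
    (mul_le_of_le_one_left (abs_nonneg _) hν1).trans hdiff
  have h6 := mul_le_mul_of_nonneg_left h5 hz0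
  linarith

variable [BorelSpace X] [TopologicalSpace.PseudoMetrizableSpace X] [IsProbabilityMeasure ν]

/-- Along a conditional limit `ρ` for `H k`, `μ` and `ζ α g ρ` differ by at most the mass which the
`μs n` lose outside `H k`. -/
theorem abs_integral_sub_limit_le (S : IsRatioApprox μ ν μs νs H a hr hlim z) {k : ℕ} {n : ℕ → ℕ}
    {ρ : Measure X} [IsProbabilityMeasure ρ] {α : ℝ≥0∞} (hn : StrictMono n) (hα0 : 0 < α)
    (hα : Tendsto (fun p => νs (n p) (H k)) atTop (𝓝 α))
    (hρ : WeaklyTendsto (fun p => ProbabilityTheory.cond (νs (n p)) (H k)) ρ)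
    {ζ : ℝ} (hζ : Tendsto (fun p => (z (n p)).toReal) atTop (𝓝 ζ)) {g : X → ℝ}
    (hg : WeakL1Limit ρ hr g)
    {δ : ℝ} (hδ : ∀ᶠ p in atTop, 1 - δ ≤ (μs (n p) (H k)).toReal) (φ : X →ᵇ ℝ) :
    |∫ s, φ s ∂μ - ζ * (α.toReal * ∫ s, φ s * g s ∂ρ)| ≤ ‖φ‖ * δ := by
  have hα1 : α ≠ ∞ := ((S.limit_mass_le_one hn hα).trans_lt ENNReal.one_lt_top).ne
  have hαr := (ENNReal.tendsto_toReal hα1).comp hα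
  have hac := S.absolutelyContinuous hn hα0 hα hρ
  have hstep : ∀ C > 0, ∀ᶠ r in atTop,
      |∫ s, φ s ∂μ - ζ * (α.toReal * ∫ s, φ s * (hr r s).toReal ∂ρ)| ≤ ‖φ‖ * (δ + ζ * C) := by
    intro C hC
    filter_upwards [S.eventually_deviation k hC] with r hr'
    have hcut : Measurable fun s => φ s * (min (hr r s) (ENNReal.ofReal (a k))).toReal :=
      φ.continuous.measurable.mul ((S.measurable r).min measurable_const).ennreal_toReal
    have hcutc : Continuous fun t : ℝ≥0∞ => (min t (ENNReal.ofReal (a k))).toReal :=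
      ENNReal.continuousOn_toReal.comp_continuous (by fun_prop)
        fun t => ((min_le_right _ _).trans_lt ENNReal.ofReal_lt_top).ne
    have hlimr := hρ.tendsto_integral_of_ae_continuousAt hcut (C := ‖φ‖ * a k) (fun s => by
        rw [abs_mul, abs_of_nonneg (ENNReal.toReal_nonneg (a := min _ _))]
        exact mul_le_mul (φ.norm_coe_le_norm s)
          (ENNReal.toReal_le_of_le_ofReal (S.pos k).le (min_le_right _ _))
          ENNReal.toReal_nonneg (norm_nonneg _)) (by
        filter_upwards [hac.ae_le (S.continuousAt r)] with s hs
        refine φ.continuous.continuousAt.mul ?_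
        exact hcutc.continuousAt.comp hs)
    have heq : ∫ s, φ s * (min (hr r s) (ENNReal.ofReal (a k))).toReal ∂ρ =
        ∫ s, φ s * (hr r s).toReal ∂ρ := by
      refine integral_congr_ae ?_
      filter_upwards [S.ae_mem_bounds hn hα0 hα hρ r] with s hs
      rw [min_eq_left hs.2]
    rw [heq] at hlimr
    refine le_of_tendsto_of_tendsto
      ((((S.weakly_mu φ).comp hn.tendsto_atTop).sub (hζ.mul (hαr.mul hlimr))).abs)
      (tendsto_const_nhds.mul (tendsto_const_nhds.add (hζ.mul_const C))) ?_
    filter_upwards [hδ, eventually_ge_atTop 1] with p hp hp1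
    have hnp : 1 ≤ n p := hp1.trans (hn.id_le p)
    refine (S.abs_integral_sub_le hnp φ hC.le (hr' _ hnp)).trans ?_
    gcongr
    linarith
  have hgr : Tendsto (fun r => |∫ s, φ s ∂μ - ζ * (α.toReal * ∫ s, φ s * (hr r s).toReal ∂ρ)|)
      atTop (𝓝 |∫ s, φ s ∂μ - ζ * (α.toReal * ∫ s, φ s * g s ∂ρ)|) := by
    refine (tendsto_const_nhds.sub (((hg.2.2 φ ?_).const_mul _).const_mul _)).abs
    exact memLp_top_of_bound φ.continuous.aestronglyMeasurable ‖φ‖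
      (Eventually.of_forall fun s => φ.norm_coe_le_norm s)
  have hC : Tendsto (fun C : ℝ => ‖φ‖ * (δ + ζ * C)) (𝓝[>] 0) (𝓝 (‖φ‖ * (δ + ζ * 0))) :=
    ((by fun_prop : Continuous fun C : ℝ => ‖φ‖ * (δ + ζ * C)).tendsto 0).mono_left
      nhdsWithin_le_nhds
  rw [mul_zero, add_zero] at hC
  refine ge_of_tendsto hC ?_
  filter_upwards [self_mem_nhdsWithin] with C hC0
  exact le_of_tendsto hgr (hstep C hC0)

variable [IsProbabilityMeasure μ]

/-- The identity `μ = ζ g ν`, for every limit point `ζ` of `z`. -/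
theorem lintegral_eq (S : IsRatioApprox μ ν μs νs H a hr hlim z) {n : ℕ → ℕ}
    {νlim : ℕ → Measure X} {k₀ : ℕ}
    (hcl : ∀ k, k₀ ≤ k → IsConditionalLimit νs (H k) n (νlim k))
    {ζ : ℝ} (hζ0 : 0 ≤ ζ) (hζ : Tendsto (fun p => (z (n p)).toReal) atTop (𝓝 ζ)) {g : X → ℝ}
    (hgm : Measurable g) (hg0 : ∀ s, 0 ≤ g s)
    (hg : ∀ k, k₀ ≤ k → WeakL1Limit (νlim k) hr g) (φ : X →ᵇ ℝ≥0) :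
    ∫⁻ s, φ s ∂μ = ENNReal.ofReal ζ * ∫⁻ s, φ s * ENNReal.ofReal (g s) ∂ν := by
  have hn : StrictMono n := (hcl k₀ le_rfl).1
  choose! α hα0 hα using fun k hk => (hcl k hk).2.2.1
  let ψ : X →ᵇ ℝ := φ.comp _ (LipschitzWith.of_edist_le (f := ((↑) : ℝ≥0 → ℝ)) fun _ _ => le_rfl)
  have hψ0 : ∀ s, 0 ≤ ψ s := fun s => NNReal.coe_nonneg _
  have hint : Tendsto (fun k => ζ * ((α k).toReal * ∫ s, ψ s * g s ∂(νlim k))) atTop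
      (𝓝 (∫ s, ψ s ∂μ)) := by
    rw [Metric.tendsto_nhds]
    intro ε hε
    obtain ⟨δ, hδ0, hδ⟩ : ∃ δ > 0, ‖ψ‖ * δ < ε :=
      ⟨ε / (‖ψ‖ + 1), by positivity, by
        rw [← mul_div_assoc, div_lt_iff₀ (by positivity)]
        nlinarith [norm_nonneg ψ]⟩
    have h1 : ENNReal.ofReal (1 - δ) < 1 := by
      rw [← ENNReal.ofReal_one]
      exact (ENNReal.ofReal_lt_ofReal_iff one_pos).2 (by linarith)
    filter_upwards [S.exhaust_mu.eventually (lt_mem_nhds h1), eventually_ge_atTop k₀] with k hk1 hk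
    have hprob := (hcl k hk).2.1
    have h2 : ∀ᶠ p in atTop, 1 - δ ≤ (μs (n p) (H k)).toReal := by
      filter_upwards [hn.tendsto_atTop.eventually (eventually_lt_of_lt_liminf hk1),
        eventually_ge_atTop 1] with p hp hp1
      have := S.isProb_mu (n p) (hp1.trans (hn.id_le p))
      exact (ENNReal.ofReal_le_iff_le_toReal (measure_ne_top _ _)).1 hp.le
    rw [dist_comm, Real.dist_eq]
    exact (S.abs_integral_sub_limit_le hn (hα0 k hk) (hα k hk) (hcl k hk).2.2.2 hζ (hg k hk) h2
      ψ).trans_lt hδ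
  have hl := S.tendsto_mul_lintegral hn (fun k hk => (hcl k hk).2.1) hα
    (fun k hk => (hcl k hk).2.2.2) (F := fun s => φ s * ENNReal.ofReal (g s))
    (by have := φ.continuous.measurable; fun_prop)
  have hμ : ENNReal.ofReal (∫ s, ψ s ∂μ) = ∫⁻ s, φ s ∂μ := by
    rw [ofReal_integral_eq_lintegral_ofReal (ψ.integrable μ) (Eventually.of_forall hψ0)]
    exact lintegral_congr fun s => ENNReal.ofReal_coe_nnreal
  rw [← hμ]
  refine tendsto_nhds_unique (ENNReal.tendsto_ofReal hint)
    ((ENNReal.Tendsto.const_mul hl (Or.inr ENNReal.ofReal_ne_top)).congr' ?_)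
  filter_upwards [eventually_ge_atTop k₀] with k hk
  have hprob := (hcl k hk).2.1
  have hα1 : α k ≠ ∞ := ((S.limit_mass_le_one hn (hα k hk)).trans_lt ENNReal.one_lt_top).ne
  rw [ENNReal.ofReal_mul hζ0, ENNReal.ofReal_mul ENNReal.toReal_nonneg, ENNReal.ofReal_toReal hα1,
    ofReal_integral_eq_lintegral_ofReal ((hg k hk).2.1.bdd_mul ψ.continuous.aestronglyMeasurable
      (Eventually.of_forall fun x => ψ.norm_coe_le_norm x))
      (Eventually.of_forall fun s => mul_nonneg (hψ0 s) (hg0 s))]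
  congr 2
  refine lintegral_congr fun s => ?_
  rw [ENNReal.ofReal_mul (hψ0 s)]
  congr 1
  exact ENNReal.ofReal_coe_nnreal.symm

omit [BorelSpace X] [TopologicalSpace.PseudoMetrizableSpace X] [IsProbabilityMeasure ν]
  [IsProbabilityMeasure μ] in
/-- Both `μs n` and `νs n` give `H k` mass at least `1/2` for a suitable `k` and all large `n`,
while their density there is `z n` up to a factor `a k`; so `z` stays in a compact subset of
`(0, ∞)`. -/
theorem exists_bounds_z (S : IsRatioApprox μ ν μs νs H a hr hlim z) :
    ∃ c C : ℝ, 0 < c ∧ ∀ᶠ n in atTop, (z n).toReal ∈ Icc c C := by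
  have hhalf : (2⁻¹ : ℝ≥0∞) < 1 := by simp
  obtain ⟨k, hkμ, hkν⟩ := ((S.exhaust_mu.eventually (lt_mem_nhds hhalf)).and
    (S.exhaust_nu.eventually (lt_mem_nhds hhalf))).exists
  have ha := S.pos k
  refine ⟨2⁻¹ / a k, 2 * a k, by positivity, ?_⟩
  filter_upwards [eventually_lt_of_lt_liminf hkμ, eventually_lt_of_lt_liminf hkν,
    eventually_ge_atTop 1] with n h1 h2 hn
  have hpμ := S.isProb_mu n hn
  have hpν := S.isProb_nu n hn
  have hzt := S.z_ne_top n hn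
  have hmass : μs n (H k) = z n * ∫⁻ s in H k, hlim s ∂(νs n) := by
    have := congrArg (fun κ : Measure X => κ univ) (S.density k n hn)
    simpa [withDensity_apply _ MeasurableSet.univ] using this
  have hae : ∀ᵐ s ∂((νs n).restrict (H k)),
      ENNReal.ofReal (a k)⁻¹ ≤ hlim s ∧ hlim s ≤ ENNReal.ofReal (a k) :=
    (ae_restrict_iff' (S.measurableSet k)).2 (S.le_lim k n hn)
  have hup : ∫⁻ s in H k, hlim s ∂(νs n) ≤ ENNReal.ofReal (a k) := by
    refine (lintegral_mono_ae (hae.mono fun s hs => hs.2)).trans ?_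
    rw [lintegral_const, Measure.restrict_apply_univ]
    exact mul_le_of_le_one_right' prob_le_one
  have hlow : ENNReal.ofReal (a k)⁻¹ * 2⁻¹ ≤ ∫⁻ s in H k, hlim s ∂(νs n) := by
    refine le_trans ?_ (lintegral_mono_ae (hae.mono fun s hs => hs.1))
    rw [lintegral_const, Measure.restrict_apply_univ]
    gcongr
  constructor
  · have h3 : (2⁻¹ : ℝ≥0∞) ≤ z n * ENNReal.ofReal (a k) := by
      refine h1.le.trans (hmass.trans_le ?_)
      gcongr
    have h4 := ENNReal.toReal_mono (ENNReal.mul_ne_top hzt ENNReal.ofReal_ne_top) h3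
    rw [ENNReal.toReal_mul, ENNReal.toReal_ofReal ha.le] at h4
    rw [div_le_iff₀ ha]
    simpa using h4
  · have h3 : z n * (ENNReal.ofReal (a k)⁻¹ * 2⁻¹) ≤ 1 := by
      refine le_trans ?_ (hmass.symm.trans_le prob_le_one)
      gcongr
    have h4 := ENNReal.toReal_mono ENNReal.one_ne_top h3
    rw [ENNReal.toReal_mul, ENNReal.toReal_mul, ENNReal.toReal_ofReal (by positivity)] at h4
    simp only [ENNReal.toReal_inv, ENNReal.toReal_ofNat, ENNReal.toReal_one] at h4
    have h5 : (z n).toReal = (z n).toReal * ((a k)⁻¹ * 2⁻¹) * (2 * a k) := by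
      field_simp
    rw [h5]
    exact mul_le_of_le_one_left (by positivity) h4

/-- The limit theorem for `IsRatioApprox`: existence of the conditional limits, of the limit density
`hinf` with its characterisation, and of the limit `ζ` of `z`. -/
theorem exists_density_limit [SecondCountableTopology X]
    (S : IsRatioApprox μ ν μs νs H a hr hlim z) :
    (∃ (n : ℕ → ℕ) (νlim : ℕ → Measure X) (k₀ : ℕ), ∀ k, k₀ ≤ k →
      IsConditionalLimit νs (H k) n (νlim k)) ∧
    ∃ (hinf : X → ℝ) (ζ : ℝ),
      Integrable hinf ν ∧ 0 ≤ᵐ[ν] hinf ∧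
      (∀ (k : ℕ) (n : ℕ → ℕ) (νk : Measure X),
        IsConditionalLimit νs (H k) n νk → WeakL1Limit νk hr hinf) ∧
      (∀ (n : ℕ → ℕ) (νlim : ℕ → Measure X) (k₀ : ℕ),
        (∀ k, k₀ ≤ k → IsConditionalLimit νs (H k) n (νlim k)) →
        ∀ g : X → ℝ, Integrable g ν →
          (∀ k, k₀ ≤ k → WeakL1Limit (νlim k) hr g) → g =ᵐ[ν] hinf) ∧
      0 < ζ ∧ Tendsto z atTop (𝓝 (ENNReal.ofReal ζ)) ∧
      μ ≪ ν ∧ μ.rnDeriv ν =ᵐ[ν] fun s => ENNReal.ofReal (ζ * hinf s) := by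
  obtain ⟨k₀, hk₀⟩ := eventually_atTop.1 (S.exhaust_nu.eventually (lt_mem_nhds zero_lt_one))
  obtain ⟨θ, νlim, hθ, hcl⟩ := S.exists_conditionalLimit hk₀ tendsto_id
  obtain ⟨G, hGm, hGi, hG⟩ := S.exists_limit_compress hcl
  refine ⟨⟨_, νlim, k₀, hcl⟩, ?_⟩
  set g : X → ℝ := fun s => max ((G s)⁻¹ - 1) 0 with hgdef
  have hgm : Measurable g := (hGm.inv.sub_const 1).max measurable_const
  have hg0 : ∀ s, 0 ≤ g s := fun s => le_max_right _ _
  have hweak : ∀ (k : ℕ) (n : ℕ → ℕ) (νk : Measure X),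
      IsConditionalLimit νs (H k) n νk → WeakL1Limit νk hr g := fun k n νk h =>
    S.weakL1Limit hgm hg0 h (S.tendsto_integral_abs_sub hGi hG h).1
      (S.tendsto_integral_abs_sub hGi hG h).2
  obtain ⟨c, C, hc0, hcC⟩ := S.exists_bounds_z
  -- along every sequence there is a subsequence along which `z` converges to some `ζ`
  have hsub : ∀ N : ℕ → ℕ, Tendsto N atTop atTop → ∃ (ms : ℕ → ℕ) (ζ : ℝ), 0 < ζ ∧
      Tendsto (fun p => (z (N (ms p))).toReal) atTop (𝓝 ζ) ∧ ∀ φ : X →ᵇ ℝ≥0,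
        ∫⁻ s, φ s ∂μ = ENNReal.ofReal ζ * ∫⁻ s, φ s * ENNReal.ofReal (g s) ∂ν := by
    intro N hN
    obtain ⟨θ', νlim', hθ', hcl'⟩ := S.exists_conditionalLimit hk₀ hN
    obtain ⟨ζ, hζ, θ'', hθ'', hlim⟩ := isCompact_Icc.tendsto_subseq'
      ((hN.comp hθ'.tendsto_atTop).eventually hcC).frequently
    have hcl'' := fun k hk => (hcl' k hk).comp hθ''
    exact ⟨fun p => θ' (θ'' p), ζ, hc0.trans_le hζ.1, hlim, S.lintegral_eq hcl''
      (hc0.trans_le hζ.1).le hlim hgm hg0 fun k hk => hweak k _ _ (hcl'' k hk)⟩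
  have hone : ∀ ζ : ℝ, (∀ φ : X →ᵇ ℝ≥0,
      ∫⁻ s, φ s ∂μ = ENNReal.ofReal ζ * ∫⁻ s, φ s * ENNReal.ofReal (g s) ∂ν) →
      ENNReal.ofReal ζ * ∫⁻ s, ENNReal.ofReal (g s) ∂ν = 1 := by
    intro ζ h
    simpa using (h (BoundedContinuousFunction.const X 1)).symm
  obtain ⟨-, ζ, hζ0, -, hζ⟩ := hsub id tendsto_id
  have hI := hone ζ hζ
  have hIfin : ∫⁻ s, ENNReal.ofReal (g s) ∂ν ≠ ∞ := by
    intro h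
    rw [h, ENNReal.mul_top (by simpa using hζ0)] at hI
    exact ENNReal.top_ne_one hI
  have hI0 : ∫⁻ s, ENNReal.ofReal (g s) ∂ν ≠ 0 := by
    intro h
    simp [h] at hI
  have hgi : Integrable g ν :=
    (lintegral_ofReal_ne_top_iff_integrable hgm.aestronglyMeasurable
      (Eventually.of_forall hg0)).1 hIfin
  have hμ : μ = ν.withDensity fun s => ENNReal.ofReal (ζ * g s) := by
    have := isFiniteMeasure_withDensity_ofReal (hgi.const_mul ζ).2
    refine ext_of_forall_lintegral_eq_of_IsFiniteMeasure fun φ => ?_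
    rw [hζ, lintegral_withDensity_eq_lintegral_mul _ (by fun_prop)
      (by have := φ.continuous.measurable; fun_prop), ← lintegral_const_mul _
      (by have := φ.continuous.measurable; fun_prop)]
    refine lintegral_congr fun s => ?_
    simp only [Pi.mul_apply]
    rw [ENNReal.ofReal_mul hζ0.le]
    ring
  refine ⟨g, ζ, hgi, Eventually.of_forall hg0, hweak, fun n νlim' k₁ hcl' g' hg' h' =>
    S.ae_eq_of_weakL1Limit hcl' hg' hgi h' fun k hk => hweak k n _ (hcl' k hk), hζ0, ?_, ?_, ?_⟩
  -- the normalisation `ζ * ∫ g dν = 1` identifies all limit points of `z`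
  · have hz : Tendsto (fun n => (z n).toReal) atTop (𝓝 ζ) := by
      refine tendsto_of_subseq_tendsto fun N hN => ?_
      obtain ⟨ms, ζ', hζ'0, hms, hζ'⟩ := hsub N hN
      have : ENNReal.ofReal ζ' = ENNReal.ofReal ζ :=
        (ENNReal.mul_left_inj hI0 hIfin).1 ((hone ζ' hζ').trans hI.symm)
      rw [ENNReal.ofReal_eq_ofReal_iff hζ'0.le hζ0.le] at this
      exact ⟨ms, this ▸ hms⟩
    refine (ENNReal.tendsto_ofReal hz).congr' ?_
    filter_upwards [eventually_ge_atTop 1] with n hn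
    exact ENNReal.ofReal_toReal (S.z_ne_top n hn)
  · rw [hμ]
    exact withDensity_absolutelyContinuous _ _
  · conv_lhs => rw [hμ]
    exact Measure.rnDeriv_withDensity ν (by fun_prop)

end IsRatioApprox

end RatioDensity

/-! ### The vague topology and its Borel sets -/

section VagueTopology

variable {R : Type*} [MetricSpace R]

/-- Cut-off functions for a family `𝓚` of bounded sets covering the space: test functions with
values in `[0, 1]` which on every member of `𝓚` are eventually equal to `1`. -/
structure IsCutoff (𝓚 : Set (Set R)) (ψ : ℕ → R →ᵇ ℝ) : Prop where
  nonneg : ∀ i x, 0 ≤ ψ i x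
  le_one : ∀ i x, ψ i x ≤ 1
  support : ∀ i, ∃ K ∈ 𝓚, Function.support (ψ i) ⊆ K
  eventually_one : ∀ K ∈ 𝓚, ∀ᶠ i in atTop, ∀ x ∈ K, ψ i x = 1
  isBounded : ∀ K ∈ 𝓚, Bornology.IsBounded K
  covers : ∀ x : R, ∃ K ∈ 𝓚, x ∈ K

theorem exists_isCutoff_bounded (o : R) :
    ∃ ψ : ℕ → R →ᵇ ℝ, IsCutoff {K : Set R | Bornology.IsBounded K} ψ := by
  let ψ : ℕ → R →ᵇ ℝ := fun i => BoundedContinuousFunction.ofNormedAddCommGroup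
    (fun x => max 0 (min 1 (i + 1 - dist x o))) (by fun_prop) 1 (fun x => by
      rw [Real.norm_of_nonneg (le_max_left _ _)]
      exact max_le zero_le_one (min_le_left _ _))
  refine ⟨ψ, fun i x => le_max_left _ _, fun i x => max_le zero_le_one (min_le_left _ _),
    fun i => ⟨Metric.closedBall o (i + 1), Metric.isBounded_closedBall, fun x hx => ?_⟩,
    fun K hK => ?_, fun K hK => hK, fun x => ⟨{x}, Bornology.isBounded_singleton, rfl⟩⟩
  · by_contra h
    rw [Metric.mem_closedBall, not_le] at h
    refine hx (max_eq_left ((min_le_right _ _).trans ?_))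
    linarith
  · obtain ⟨ρ, hρ⟩ := (Metric.isBounded_iff_subset_closedBall o).1 hK
    obtain ⟨N, hN⟩ := exists_nat_ge ρ
    filter_upwards [eventually_ge_atTop N] with i hi x hx
    have h1 : dist x o ≤ ρ := hρ hx
    have h2 : (N : ℝ) ≤ i := by exact_mod_cast hi
    change max 0 (min 1 ((i : ℝ) + 1 - dist x o)) = 1
    rw [min_eq_left (by linarith), max_eq_right zero_le_one]

theorem exists_isCutoff_compact [LocallyCompactSpace R] [SecondCountableTopology R] :
    ∃ ψ : ℕ → R →ᵇ ℝ, IsCutoff {K : Set R | IsCompact K} ψ := by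
  let E : CompactExhaustion R := default
  choose f h1 _ hc h01 using fun i => exists_continuous_one_zero_of_isCompact (E.isCompact i)
    isClosed_empty (disjoint_empty _)
  let ψ : ℕ → R →ᵇ ℝ := fun i => BoundedContinuousFunction.ofNormedAddCommGroup (f i)
    (f i).continuous 1 (fun x => by
      rw [Real.norm_of_nonneg (h01 i x).1]
      exact (h01 i x).2)
  refine ⟨ψ, fun i x => (h01 i x).1, fun i x => (h01 i x).2,
    fun i => ⟨tsupport (f i), hc i, subset_tsupport (f i)⟩, fun K hK => ?_,
    fun K hK => hK.isBounded, fun x => ⟨{x}, isCompact_singleton, rfl⟩⟩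
  obtain ⟨N, hN⟩ := E.exists_superset_of_isCompact hK
  filter_upwards [eventually_ge_atTop N] with i hi x hx
  exact h1 i (E.subset hi (hN hx))

variable [MeasurableSpace R]

/-- The two admissible topologies are treated together: each of them has cut-off functions. -/
theorem IsVagueTopology.exists_isCutoff [SecondCountableTopology R] (o : R)
    {τ : TopologicalSpace (Conf R)} (hτ : IsVagueTopology τ) :
    ∃ (𝓚 : Set (Set R)) (ψ : ℕ → R →ᵇ ℝ), IsCutoff 𝓚 ψ ∧ τ = testTopology 𝓚 := by
  rcases hτ with h | ⟨_, h⟩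
  · obtain ⟨ψ, hψ⟩ := exists_isCutoff_bounded o
    exact ⟨_, ψ, hψ, h⟩
  · obtain ⟨ψ, hψ⟩ := exists_isCutoff_compact (R := R)
    exact ⟨_, ψ, hψ, h⟩

theorem Conf.ext {s t : Conf R} (h : s.toMeasure = t.toMeasure) : s = t := by
  cases s
  cases t
  congr

theorem Conf.measure_lt_top_of_isBounded (s : Conf R) {K : Set R} (hK : Bornology.IsBounded K) :
    s.toMeasure K < ∞ := by
  rcases K.eq_empty_or_nonempty with rfl | ⟨x, -⟩
  · simp
  · obtain ⟨ρ, hρ⟩ := hK.subset_ball x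
    exact (measure_mono hρ).trans_lt (s.finite_on_balls x ρ)

/-- A countable family generating the vague topology: lower bounds for the masses of finite unions
of basic open sets, and upper bounds for the integrals of the cut-off functions. -/
def vagueSubbasis [SecondCountableTopology R] (ψ : ℕ → R →ᵇ ℝ) : Set (Set (Conf R)) :=
  (⋃ q : ℚ, (fun F => {s : Conf R | ENNReal.ofReal q < s.toMeasure (⋃₀ F)}) ''
    {F | F.Finite ∧ F ⊆ TopologicalSpace.countableBasis R}) ∪
  range fun p : ℕ × ℚ => {s : Conf R | ∫ x, ψ p.1 x ∂s.toMeasure < p.2}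

theorem countable_vagueSubbasis [SecondCountableTopology R] (ψ : ℕ → R →ᵇ ℝ) :
    (vagueSubbasis ψ).Countable :=
  (countable_iUnion fun _ => (countable_ofPred_finite_subset
    (TopologicalSpace.countable_countableBasis R)).image _).union (countable_range _)

/-- The mass of an open set is approximated from below by masses of finite unions of basic sets. -/
theorem exists_finite_basis_lt_measure [SecondCountableTopology R] (s : Measure R)
    {U : Set R} (hU : IsOpen U) {c : ℝ≥0∞} (hc : c < s U) :
    ∃ F : Set (Set R), F.Finite ∧ F ⊆ TopologicalSpace.countableBasis R ∧ ⋃₀ F ⊆ U ∧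
      c < s (⋃₀ F) := by
  obtain ⟨S, hS, hSc, rfl⟩ :=
    (TopologicalSpace.isBasis_countableBasis R).exists_countable_biUnion_of_isOpen hU
  have := hSc.to_subtype
  have h1 : (⋃ A ∈ S, A) = ⋃ T : Finset S, ⋃₀ (Subtype.val '' (T : Set S)) := by
    ext x
    simp only [mem_iUnion, mem_sUnion]
    constructor
    · rintro ⟨A, hA, hx⟩
      exact ⟨{⟨A, hA⟩}, A, by simp, hx⟩
    · rintro ⟨T, _, ⟨A, -, rfl⟩, hx⟩
      exact ⟨A, A.2, hx⟩
  have hdir : Directed (· ⊆ ·) fun T : Finset S => ⋃₀ (Subtype.val '' (T : Set S)) := by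
    classical
    intro T T'
    refine ⟨T ∪ T', ?_, ?_⟩ <;> refine sUnion_subset_sUnion (image_mono ?_) <;> simp
  rw [h1, hdir.measure_iUnion, lt_iSup_iff] at hc
  obtain ⟨T, hT⟩ := hc
  refine ⟨_, T.finite_toSet.image _, ?_, ?_, hT⟩
  · rintro _ ⟨A, -, rfl⟩
    exact hS A.2
  · rw [h1]
    exact subset_iUnion_of_subset T le_rfl

theorem regularSpace_testTopology (𝓚 : Set (Set R)) :
    @RegularSpace (Conf R) (testTopology 𝓚) :=
  regularSpace_iInf fun _ => regularSpace_iInf fun _ => regularSpace_induced _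

namespace IsCutoff

variable {𝓚 : Set (Set R)} {ψ : ℕ → R →ᵇ ℝ}

theorem integrable [OpensMeasurableSpace R] (hψ : IsCutoff 𝓚 ψ) (s : Conf R)
    {f : R →ᵇ ℝ} {K : Set R}
    (hK : K ∈ 𝓚) (hf : Function.support f ⊆ K) : Integrable f s.toMeasure := by
  rw [← integrableOn_iff_integrable_of_support_subset (f := f) (μ := s.toMeasure)
    (hf.trans subset_closure)]
  exact Measure.integrableOn_of_bounded
    (s.measure_lt_top_of_isBounded (hψ.isBounded K hK).closure).ne
    f.continuous.aestronglyMeasurable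
    (M := ‖f‖) (Eventually.of_forall fun x => f.norm_coe_le_norm x)

theorem continuous_integral {f : R →ᵇ ℝ} {K : Set R} (hK : K ∈ 𝓚) (hf : Function.support f ⊆ K) :
    Continuous[testTopology 𝓚, _] fun s : Conf R => ∫ x, f x ∂s.toMeasure :=
  continuous_iff_le_induced.2 (iInf₂_le f ⟨K, hK, hf⟩)

/-- The mass of an open set is a supremum of integrals of test functions, hence lower
semicontinuous. -/
theorem isOpen_lt_measure [OpensMeasurableSpace R] (hψ : IsCutoff 𝓚 ψ) {U : Set R} (hU : IsOpen U)
    (c : ℝ≥0∞) : IsOpen[testTopology 𝓚] {s : Conf R | c < s.toMeasure U} := by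
  -- test functions with `0 ≤ χ i ≤ 1_U` and `χ i → 1_U` pointwise
  let χ : ℕ → R →ᵇ ℝ := fun i => ψ i * (1 - (hU.isClosed_compl.apprSeq i).comp _
    (LipschitzWith.of_edist_le (f := ((↑) : ℝ≥0 → ℝ)) fun _ _ => le_rfl))
  have hχ : ∀ i x, χ i x = ψ i x * (1 - (hU.isClosed_compl.apprSeq i x : ℝ)) := fun i x => rfl
  have happ1 : ∀ i x, (hU.isClosed_compl.apprSeq i x : ℝ) ≤ 1 := fun i x => by
    exact_mod_cast HasOuterApproxClosed.apprSeq_apply_le_one hU.isClosed_compl i x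
  have hχ0 : ∀ i x, 0 ≤ χ i x := fun i x =>
    mul_nonneg (hψ.nonneg i x) (sub_nonneg.2 (happ1 i x))
  have hχ1 : ∀ i x, ENNReal.ofReal (χ i x) ≤ U.indicator 1 x := by
    intro i x
    by_cases hx : x ∈ U
    · rw [indicator_of_mem hx, Pi.one_apply, ENNReal.ofReal_le_one, hχ]
      exact mul_le_one₀ (hψ.le_one i x) (sub_nonneg.2 (happ1 i x))
        (sub_le_self _ (NNReal.coe_nonneg _))
    · rw [indicator_of_notMem hx, hχ,
        HasOuterApproxClosed.apprSeq_apply_eq_one hU.isClosed_compl i (mem_compl hx)]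
      simp
  have hsupp : ∀ i, ∃ K ∈ 𝓚, Function.support (χ i) ⊆ K := fun i => by
    obtain ⟨K, hK, h⟩ := hψ.support i
    refine ⟨K, hK, fun x hx => h fun h0 => hx ?_⟩
    rw [hχ, h0, zero_mul]
  have hlimχ : ∀ x, Tendsto (fun i => ENNReal.ofReal (χ i x)) atTop (𝓝 (U.indicator 1 x)) := by
    intro x
    obtain ⟨K, hK, hxK⟩ := hψ.covers x
    have h1 : Tendsto (fun i => ψ i x) atTop (𝓝 1) := tendsto_const_nhds.congr' <| by
      filter_upwards [hψ.eventually_one K hK] with i hi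
      rw [hi x hxK]
    have h2 := (NNReal.tendsto_coe.2 (tendsto_pi_nhds.1
      (HasOuterApproxClosed.tendsto_apprSeq hU.isClosed_compl) x))
    have h3 := ENNReal.tendsto_ofReal (h1.mul (tendsto_const_nhds (x := (1 : ℝ)) |>.sub h2))
    refine (h3.congr fun i => by rw [hχ]).trans (le_of_eq ?_)
    congr 1
    by_cases hx : x ∈ U
    · simp [hx]
    · simp [hx]
  have hset : {s : Conf R | c < s.toMeasure U} =
      ⋃ i, (fun s : Conf R => ∫ x, χ i x ∂s.toMeasure) ⁻¹' {y | c < ENNReal.ofReal y} := by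
    ext s
    have hint : ∀ i, ENNReal.ofReal (∫ x, χ i x ∂s.toMeasure) =
        ∫⁻ x, ENNReal.ofReal (χ i x) ∂s.toMeasure := fun i => by
      obtain ⟨K, hK, h⟩ := hsupp i
      exact ofReal_integral_eq_lintegral_ofReal (hψ.integrable s hK h)
        (Eventually.of_forall (hχ0 i))
    simp only [mem_iUnion, mem_preimage, mem_ofPred_eq, hint]
    rw [← lintegral_indicator_one hU.measurableSet]
    constructor
    · intro h
      have h1 : ∫⁻ x, U.indicator 1 x ∂s.toMeasure ≤
          liminf (fun i => ∫⁻ x, ENNReal.ofReal (χ i x) ∂s.toMeasure) atTop := by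
        refine (lintegral_congr fun x => (hlimχ x).liminf_eq.symm).trans_le
          (lintegral_liminf_le fun i => (χ i).continuous.measurable.ennreal_ofReal)
      exact (eventually_lt_of_lt_liminf (h.trans_le h1)).exists
    · rintro ⟨i, hi⟩
      exact hi.trans_le (lintegral_mono (hχ1 i))
  rw [hset]
  let := testTopology 𝓚
  refine isOpen_iUnion fun i => ?_
  obtain ⟨K, hK, h⟩ := hsupp i
  exact (isOpen_lt continuous_const ENNReal.continuous_ofReal).preimage (continuous_integral hK h)

/-- The countable family `vagueSubbasis ψ` generates the topology. It controls the masses of open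
sets from below, hence by Fatou's lemma the integrals of nonnegative test functions; applied to
`‖f‖ ψ ± f`, together with the upper bounds for `∫ ψ`, this yields the continuity of `∫ f`. -/
theorem testTopology_eq_generateFrom [OpensMeasurableSpace R] [SecondCountableTopology R]
    (hψ : IsCutoff 𝓚 ψ) :
    testTopology 𝓚 = TopologicalSpace.generateFrom (vagueSubbasis ψ) := by
  refine le_antisymm (le_generateFrom ?_) ?_
  · rintro _ (h | ⟨⟨i, q⟩, rfl⟩)
    · obtain ⟨q, F, ⟨-, hF⟩, rfl⟩ := mem_iUnion.1 h
      exact hψ.isOpen_lt_measure (isOpen_sUnion fun A hA =>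
        TopologicalSpace.isOpen_of_mem_countableBasis (hF hA)) _
    · let := testTopology 𝓚
      obtain ⟨K, hK, h⟩ := hψ.support i
      exact isOpen_lt (continuous_integral hK h) continuous_const
  · let : TopologicalSpace (Conf R) := TopologicalSpace.generateFrom (vagueSubbasis ψ)
    have : SecondCountableTopology (Conf R) := ⟨⟨_, countable_vagueSubbasis ψ, rfl⟩⟩
    refine le_iInf₂ fun f hf => continuous_iff_le_induced.1 ?_
    obtain ⟨K, hK, hfK⟩ := hf
    refine continuous_iff_seqContinuous.2 fun t s hts => ?_
    have hopen : ∀ U : Set R, IsOpen U →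
        s.toMeasure U ≤ liminf (fun i => (t i).toMeasure U) atTop := by
      intro U hU
      refine le_of_forall_lt fun c hc => ?_
      obtain ⟨q, -, hcq, hq⟩ := ENNReal.lt_iff_exists_rat_btwn.1 hc
      obtain ⟨F, hFf, hFb, hFU, hF⟩ := exists_finite_basis_lt_measure s.toMeasure hU hq
      have h1 : IsOpen {s : Conf R | ENNReal.ofReal q < s.toMeasure (⋃₀ F)} :=
        TopologicalSpace.isOpen_generateFrom_of_mem
          (Or.inl (mem_iUnion.2 ⟨q, F, ⟨hFf, hFb⟩, rfl⟩))
      refine hcq.trans_le (le_liminf_of_le (by isBoundedDefault) ?_)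
      filter_upwards [hts.eventually (h1.mem_nhds hF)] with i hi
      exact hi.le.trans (measure_mono hFU)
    have hlow : ∀ (g : R →ᵇ ℝ) (K : Set R), K ∈ 𝓚 → Function.support g ⊆ K → (∀ x, 0 ≤ g x) →
        ∀ ε > 0, ∀ᶠ i in atTop, ∫ x, g x ∂s.toMeasure - ε < ∫ x, g x ∂(t i).toMeasure := by
      intro g K hK hgK hg0 ε hε
      have hint : ∀ s : Conf R, ENNReal.ofReal (∫ x, g x ∂s.toMeasure) =
          ∫⁻ x, ENNReal.ofReal (g x) ∂s.toMeasure := fun s =>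
        ofReal_integral_eq_lintegral_ofReal (hψ.integrable s hK hgK) (Eventually.of_forall hg0)
      have hI0 : ∀ s : Conf R, 0 ≤ ∫ x, g x ∂s.toMeasure := fun s => integral_nonneg hg0
      rcases lt_or_ge (∫ x, g x ∂s.toMeasure - ε) 0 with hneg | hpos
      · exact Eventually.of_forall fun i => hneg.trans_le (hI0 _)
      have h1 := lintegral_le_liminf_lintegral_of_forall_isOpen_measure_le_liminf_measure
        g.continuous hg0 hopen
      have h2 : ENNReal.ofReal (∫ x, g x ∂s.toMeasure - ε) <
          ∫⁻ x, ENNReal.ofReal (g x) ∂s.toMeasure := by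
        rw [← hint, ENNReal.ofReal_lt_ofReal_iff_of_nonneg hpos]
        linarith
      filter_upwards [eventually_lt_of_lt_liminf (h2.trans_le h1)] with i hi
      rwa [← hint, ENNReal.ofReal_lt_ofReal_iff_of_nonneg hpos] at hi
    obtain ⟨i, hi⟩ := (hψ.eventually_one K hK).exists
    obtain ⟨K', hK', hψK'⟩ := hψ.support i
    have hsupp : Function.support f ⊆ Function.support (ψ i) := fun x hx => by
      rw [Function.mem_support, hi x (hfK hx)]
      exact one_ne_zero
    have hψlim : ∀ ε > 0, ∀ᶠ j in atTop,
        ∫ x, ψ i x ∂(t j).toMeasure < ∫ x, ψ i x ∂s.toMeasure + ε := by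
      intro ε hε
      obtain ⟨q, hq1, hq2⟩ := exists_rat_btwn (lt_add_of_pos_right (∫ x, ψ i x ∂s.toMeasure) hε)
      have h1 : IsOpen {s : Conf R | ∫ x, ψ i x ∂s.toMeasure < q} :=
        TopologicalSpace.isOpen_generateFrom_of_mem (Or.inr ⟨(i, q), rfl⟩)
      filter_upwards [hts.eventually (h1.mem_nhds hq1)] with j hj
      exact lt_trans hj hq2
    -- both `‖f‖ ψ + f` and `‖f‖ ψ - f` are nonnegative test functions
    have hfψ : ∀ x, |f x| ≤ ‖f‖ * ψ i x := by
      intro x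
      by_cases hx : f x = 0
      · rw [hx, abs_zero]
        exact mul_nonneg (norm_nonneg _) (hψ.nonneg i x)
      · rw [hi x (hfK hx), mul_one]
        exact f.norm_coe_le_norm x
    have hcomb : ∀ c : ℝ, Function.support (‖f‖ • ψ i + c • f : R →ᵇ ℝ) ⊆ K' := by
      intro c x hx
      by_contra h
      have h0 : ψ i x = 0 := by
        by_contra h0
        exact h (hψK' h0)
      have h1 : f x = 0 := by
        by_contra h1
        exact hsupp h1 h0
      exact hx (by simp [h0, h1])
    have hsplit : ∀ (c : ℝ) (s : Conf R), ∫ x, (‖f‖ • ψ i + c • f : R →ᵇ ℝ) x ∂s.toMeasure =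
        ‖f‖ * ∫ x, ψ i x ∂s.toMeasure + c * ∫ x, f x ∂s.toMeasure := by
      intro c s
      rw [← integral_const_mul, ← integral_const_mul]
      exact integral_add ((hψ.integrable s hK' hψK').const_mul _)
        ((hψ.integrable s hK hfK).const_mul _)
    have hpos := hlow (‖f‖ • ψ i + (1 : ℝ) • f) K' hK' (hcomb 1) fun x => by
      have := (abs_le.1 (hfψ x)).1
      simp only [BoundedContinuousFunction.coe_add, BoundedContinuousFunction.coe_smul,
        Pi.add_apply, smul_eq_mul]
      linarith
    have hneg := hlow (‖f‖ • ψ i + (-1 : ℝ) • f) K' hK' (hcomb (-1)) fun x => by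
      have := (abs_le.1 (hfψ x)).2
      simp only [BoundedContinuousFunction.coe_add, BoundedContinuousFunction.coe_smul,
        Pi.add_apply, smul_eq_mul]
      linarith
    refine Metric.tendsto_nhds.2 fun ε hε => ?_
    obtain ⟨η, hη0, hη⟩ : ∃ η > 0, ‖f‖ * η < ε / 2 :=
      ⟨ε / 2 / (‖f‖ + 1), by positivity, by
        rw [← mul_div_assoc, div_lt_iff₀ (by positivity)]
        nlinarith [norm_nonneg f]⟩
    filter_upwards [hpos (ε / 2) (by positivity), hneg (ε / 2) (by positivity), hψlim η hη0]
      with j h1 h2 h3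
    rw [hsplit, hsplit] at h1 h2
    have h4 := mul_le_mul_of_nonneg_left h3.le (norm_nonneg f)
    simp only [Function.comp]
    rw [Real.dist_eq, abs_lt]
    constructor <;> linarith

theorem secondCountableTopology [OpensMeasurableSpace R] [SecondCountableTopology R]
    (hψ : IsCutoff 𝓚 ψ) : @SecondCountableTopology (Conf R) (testTopology 𝓚) :=
  let := testTopology 𝓚
  ⟨⟨_, countable_vagueSubbasis ψ, hψ.testTopology_eq_generateFrom⟩⟩

theorem t0Space [BorelSpace R] (hψ : IsCutoff 𝓚 ψ) : @T0Space (Conf R) (testTopology 𝓚) := by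
  let := testTopology 𝓚
  refine ⟨fun s t hst => Conf.ext ?_⟩
  rcases isEmpty_or_nonempty R with hR | ⟨⟨o⟩⟩
  · exact Subsingleton.elim _ _
  have hle : ∀ {s t : Conf R}, Inseparable s t → ∀ U : Set R, IsOpen U →
      s.toMeasure U ≤ t.toMeasure U := by
    intro s t hst U hU
    by_contra h
    exact lt_irrefl (t.toMeasure U) ((hst.mem_open_iff (hψ.isOpen_lt_measure hU _)).1 (not_le.1 h))
  refine Measure.ext_of_generateFrom_of_iUnion {U : Set R | IsOpen U}
    (fun i : ℕ => Metric.ball o i) (BorelSpace.measurable_eq.trans rfl)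
    isPiSystem_isOpen (Metric.iUnion_ball_nat o) (fun i => Metric.isOpen_ball)
    (fun i => (s.finite_on_balls o i).ne) fun U hU => le_antisymm (hle hst U hU)
      (hle hst.symm U hU)

end IsCutoff

section Borel

variable [BorelSpace R] [SecondCountableTopology R] [τ : TopologicalSpace (Conf R)]
  [MeasurableSpace (Conf R)] [BorelSpace (Conf R)]

theorem IsVagueTopology.isOpen_lt_measure (hτ : IsVagueTopology τ) {U : Set R} (hU : IsOpen U)
    (c : ℝ≥0∞) : IsOpen {s : Conf R | c < s.toMeasure U} := by
  rcases isEmpty_or_nonempty R with hR | ⟨⟨o⟩⟩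
  · have : Subsingleton (Conf R) := ⟨fun s t => Conf.ext (Subsingleton.elim _ _)⟩
    exact isOpen_discrete _
  · obtain ⟨𝓚, ψ, hψ, rfl⟩ := hτ.exists_isCutoff o
    exact hψ.isOpen_lt_measure hU c

/-- The Borel structure of the vague topology makes every `s ↦ s B` measurable, by a `π`-`λ`
argument on bounded balls. -/
theorem IsVagueTopology.measurable_toMeasure (hτ : IsVagueTopology τ) (o : R) :
    Measurable (Conf.toMeasure : Conf R → Measure R) := by
  have hopen : ∀ U : Set R, IsOpen U → Measurable fun s : Conf R => s.toMeasure U := fun U hU =>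
    measurable_of_Ioi fun c => (hτ.isOpen_lt_measure hU c).measurableSet
  have hball : ∀ i : ℕ, Measurable fun s : Conf R => s.toMeasure.restrict (Metric.ball o i) := by
    intro i
    have : ∀ s : Conf R, IsFiniteMeasure (s.toMeasure.restrict (Metric.ball o i)) := fun s =>
      ⟨by rw [Measure.restrict_apply_univ]; exact s.finite_on_balls o i⟩
    refine Measurable.measure_of_isPiSystem (S := {U : Set R | IsOpen U})
      (BorelSpace.measurable_eq.trans rfl) isPiSystem_isOpen (fun U hU => ?_) ?_
    · simp_rw [Measure.restrict_apply (IsOpen.measurableSet hU)]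
      exact hopen _ (IsOpen.inter hU Metric.isOpen_ball)
    · simp_rw [Measure.restrict_apply_univ]
      exact hopen _ Metric.isOpen_ball
  refine Measure.measurable_of_measurable_coe _ fun B hB => ?_
  have h1 : ∀ s : Conf R, s.toMeasure B =
      ⨆ i : ℕ, s.toMeasure.restrict (Metric.ball o i) B := by
    intro s
    simp_rw [Measure.restrict_apply hB]
    rw [← Monotone.measure_iUnion, ← inter_iUnion, Metric.iUnion_ball_nat, inter_univ]
    exact fun i j hij => inter_subset_inter_right _
      (Metric.ball_subset_ball (by exact_mod_cast hij))
  simp_rw [h1]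
  exact Measurable.iSup fun i => (Measure.measurable_coe hB).comp (hball i)

/-- Conversely the Borel structure is generated by the evaluations `s ↦ s B`. -/
theorem IsVagueTopology.measurable_of_measurable_toMeasure (hτ : IsVagueTopology τ) (o : R)
    {Y : Type*} [MeasurableSpace Y] {κ : Y → Conf R} (hκ : Measurable fun y => (κ y).toMeasure) :
    Measurable κ := by
  obtain ⟨𝓚, ψ, hψ, h𝓚⟩ := hτ.exists_isCutoff o
  have : SecondCountableTopology (Conf R) := h𝓚 ▸ hψ.secondCountableTopology
  have hgen : ‹MeasurableSpace (Conf R)› = MeasurableSpace.generateFrom (vagueSubbasis ψ) :=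
    BorelSpace.measurable_eq.trans
      (borel_eq_generateFrom_of_subbasis (h𝓚.trans hψ.testTopology_eq_generateFrom))
  rw [hgen]
  refine measurable_generateFrom ?_
  rintro _ (h | ⟨⟨i, q⟩, rfl⟩)
  · obtain ⟨q, F, ⟨-, hF⟩, rfl⟩ := mem_iUnion.1 h
    refine measurableSet_lt measurable_const ((Measure.measurable_coe ?_).comp hκ)
    exact (isOpen_sUnion fun A hA =>
      TopologicalSpace.isOpen_of_mem_countableBasis (hF hA)).measurableSet
  · have h1 : ∀ y, ∫ x, ψ i x ∂(κ y).toMeasure =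
        (∫⁻ x, ENNReal.ofReal (ψ i x) ∂(κ y).toMeasure).toReal := fun y =>
      integral_eq_lintegral_of_nonneg_ae (Eventually.of_forall (hψ.nonneg i))
        (ψ i).continuous.aestronglyMeasurable
    simp only [preimage_ofPred_eq, h1]
    refine measurableSet_lt (Measurable.ennreal_toReal ?_) measurable_const
    exact (Measure.measurable_lintegral (ψ i).continuous.measurable.ennreal_ofReal).comp hκ

end Borel

end VagueTopology

/-! ### Finite configurations as labelled points -/

section FiniteConfigurations

variable {R : Type*} [MetricSpace R] [MeasurableSpace R] [BorelSpace R] [SecondCountableTopology R]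

/-- An integer-valued finite measure is a sum of Dirac masses: a point without mass has a
neighbourhood of mass less than `1`, hence `0`, so that a nonzero measure has an atom, which can be
split off. -/
theorem exists_eq_sum_dirac (n : ℕ) : ∀ s : Measure R,
    (∀ B, MeasurableSet B → ∃ j : ℕ∞, s B = (j : ℝ≥0∞)) → s univ = n →
      ∃ x : Fin n → R, s = ∑ i, Measure.dirac (x i) := by
  induction n with
  | zero =>
    intro s _ hs
    exact ⟨Fin.elim0, by simpa using hs⟩
  | succ n ih =>
    intro s hs hn
    have hfin : IsFiniteMeasure s := ⟨by rw [hn]; exact ENNReal.natCast_lt_top _⟩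
    have hone : ∀ B, MeasurableSet B → s B ≠ 0 → 1 ≤ s B := by
      intro B hB h0
      obtain ⟨j, hj⟩ := hs B hB
      rw [hj] at h0 ⊢
      have : (1 : ℕ∞) ≤ j := Order.one_le_iff_pos.2 (pos_iff_ne_zero.2 fun h => h0 (by simp [h]))
      exact_mod_cast this
    obtain ⟨x, hx⟩ : ∃ x, s {x} ≠ 0 := by
      by_contra! h
      have h0 : s univ = 0 := by
        refine measure_null_of_locally_null univ fun x _ => ?_
        obtain ⟨U, hxU, hU, hU1⟩ := ({x} : Set R).exists_isOpen_lt_of_lt (μ := s) 1 (by simp [h x])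
        refine ⟨U, mem_nhdsWithin_of_mem_nhds (hU.mem_nhds (hxU rfl)), ?_⟩
        by_contra h1
        exact absurd hU1 (not_lt.2 (hone U hU.measurableSet h1))
      rw [hn] at h0
      exact (Nat.cast_ne_zero.2 n.succ_ne_zero) h0
    have hle : Measure.dirac x ≤ s := by
      refine Measure.le_iff.2 fun B hB => ?_
      rw [Measure.dirac_apply' _ hB]
      by_cases hxB : x ∈ B
      · simpa [hxB] using (hone {x} (measurableSet_singleton x) hx).trans
          (measure_mono (singleton_subset_iff.2 hxB))
      · simp [hxB]
    obtain ⟨y, hy⟩ := ih (s - Measure.dirac x) (fun B hB => by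
        obtain ⟨j, hj⟩ := hs B hB
        rw [Measure.sub_apply hB hle, hj, Measure.dirac_apply' _ hB]
        by_cases hxB : x ∈ B
        · exact ⟨j - 1, by simp [hxB]⟩
        · exact ⟨j, by simp [hxB]⟩) (by
        rw [Measure.sub_apply MeasurableSet.univ hle, hn, measure_univ, Nat.cast_succ]
        exact ENNReal.add_sub_cancel_right ENNReal.one_ne_top)
    refine ⟨Fin.cons x y, ?_⟩
    rw [Fin.sum_univ_succ]
    simp only [Fin.cons_zero, Fin.cons_succ]
    rw [← hy, add_comm, Measure.sub_add_cancel_of_le hle]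

theorem Conf.exists_ofPoints {s : Conf R} {n : ℕ} (hs : s.toMeasure univ = n) :
    ∃ x : Fin n → R, (ofPoints x).1 = s := by
  obtain ⟨x, hx⟩ := exists_eq_sum_dirac n s.toMeasure s.integer_valued hs
  exact ⟨x, Conf.ext hx.symm⟩

omit [BorelSpace R] [SecondCountableTopology R] in
theorem Conf.exists_measure_univ_eq {s : Conf R} (hs : s.toMeasure univ < ∞) :
    ∃ n : ℕ, s.toMeasure univ = n := by
  obtain ⟨j, hj⟩ := s.integer_valued univ MeasurableSet.univ
  have hjtop : j ≠ ⊤ := by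
    rintro rfl
    exact hs.ne (by simpa using hj)
  lift j to ℕ using hjtop
  exact ⟨j, by simpa using hj⟩

omit [BorelSpace R] [SecondCountableTopology R] in
theorem ofPoints_measure_univ {n : ℕ} (x : Fin n → R) : (ofPoints x).1.toMeasure univ = n := by
  change (∑ i, Measure.dirac (x i) : Measure R) univ = n
  simp

theorem range_ofPoints (n : ℕ) :
    range (fun x : Fin n → R => (ofPoints x).1) = {s : Conf R | s.toMeasure univ = n} :=
  Subset.antisymm (range_subset_iff.2 ofPoints_measure_univ) fun _ hs => Conf.exists_ofPoints hs

theorem IsVagueTopology.continuous_ofPoints {τ : TopologicalSpace (Conf R)}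
    (hτ : IsVagueTopology τ) (n : ℕ) : Continuous fun x : Fin n → R => (ofPoints x).1 := by
  have key : ∀ 𝓚 : Set (Set R),
      Continuous[_, testTopology 𝓚] fun x : Fin n → R => (ofPoints x).1 := by
    intro 𝓚
    refine continuous_iInf_rng.2 fun f => continuous_iInf_rng.2 fun _ =>
      continuous_induced_rng.2 ?_
    have : ∀ x : Fin n → R, ∫ y, f y ∂(ofPoints x).1.toMeasure = ∑ i, f (x i) := by
      intro x
      change ∫ y, f y ∂(∑ i, Measure.dirac (x i)) = _
      rw [integral_finsetSum_measure fun i _ => f.integrable _]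
      simp
    simp only [Function.comp_def, this]
    fun_prop
  rcases hτ with rfl | ⟨_, rfl⟩ <;> exact key _

/-- The extension by `0` of a function of the finite configurations to all configurations. -/
noncomputable def extendFin (h : FinConf R → ℝ≥0∞) (s : Conf R) : ℝ≥0∞ :=
  open Classical in if hs : s.toMeasure univ < ∞ then h ⟨s, hs⟩ else 0

omit [BorelSpace R] [SecondCountableTopology R] in
theorem extendFin_coe (h : FinConf R → ℝ≥0∞) (s : FinConf R) : extendFin h s.1 = h s :=
  dif_pos s.2

omit [SecondCountableTopology R] in
theorem inside_eq_self {o : R} {b : ℕ → ℝ} (hb : Tendsto b atTop atTop) {n : ℕ} (x : Fin n → R) :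
    ∀ᶠ r in atTop, inside o (b r) (ofPoints x).1 = ofPoints x := by
  have h : ∀ᶠ r in atTop, ∀ i, dist (x i) o < b r :=
    eventually_all.2 fun i => hb.eventually_gt_atTop _
  filter_upwards [h] with r hr
  refine Subtype.ext (Conf.ext ?_)
  refine Measure.restrict_eq_self_of_ae_mem ?_
  change ∀ᵐ y ∂(∑ i, Measure.dirac (x i) : Measure R), y ∈ Metric.ball o (b r)
  rw [ae_iff, Measure.finsetSum_apply]
  refine Finset.sum_eq_zero fun i _ => ?_
  change Measure.dirac (x i) (Metric.ball o (b r))ᶜ = 0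
  rw [Measure.dirac_apply' _ measurableSet_ball.compl]
  simpa using hr i

/-- For a finite configuration `h_r` is eventually equal to `h`. This is where `b r → ∞` is used. -/
theorem innerPart_eventually_eq {o : R} {b : ℕ → ℝ} (hb : Tendsto b atTop atTop)
    (h : FinConf R → ℝ≥0∞) (s : FinConf R) : ∀ᶠ r in atTop, innerPart h o b r s.1 = h s := by
  obtain ⟨n, hn⟩ := Conf.exists_measure_univ_eq s.2
  obtain ⟨x, hx⟩ := Conf.exists_ofPoints hn
  have hx' : ofPoints x = s := Subtype.ext hx
  subst hx'
  filter_upwards [inside_eq_self (o := o) hb x] with r hr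
  rw [innerPart, hr]

section Borel

variable [CompleteSpace R] [τ : TopologicalSpace (Conf R)] [MeasurableSpace (Conf R)]
  [BorelSpace (Conf R)]

omit [CompleteSpace R] in
theorem IsVagueTopology.secondCountable_regular_t0 (hτ : IsVagueTopology τ) (o : R) :
    SecondCountableTopology (Conf R) ∧ RegularSpace (Conf R) ∧ T0Space (Conf R) := by
  obtain ⟨𝓚, ψ, hψ, h⟩ := hτ.exists_isCutoff o
  subst h
  exact ⟨hψ.secondCountableTopology, regularSpace_testTopology 𝓚, hψ.t0Space⟩

/-- By the Lusin separation theorem, a function of the finite configurations is Borel as soon as it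
is Borel as a function of the labelled points. -/
theorem measurable_extendFin (hτ : IsVagueTopology τ) (o : R) {h : FinConf R → ℝ≥0∞}
    (hh : ∀ n, Measurable fun x : Fin n → R => h (ofPoints x)) : Measurable (extendFin h) := by
  obtain ⟨_, _, _⟩ := hτ.secondCountable_regular_t0 o
  have huniv : Measurable fun s : Conf R => s.toMeasure univ :=
    (Measure.measurable_coe MeasurableSet.univ).comp (hτ.measurable_toMeasure o)
  have hQ : ∀ c : ℝ≥0∞, MeasurableSet {s : Conf R | s.toMeasure univ = c} := fun c =>
    huniv (measurableSet_singleton c)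
  have hpiece : ∀ (n : ℕ) {B : Set ℝ≥0∞}, MeasurableSet B →
      MeasurableSet (extendFin h ⁻¹' B ∩ {s : Conf R | s.toMeasure univ = n}) := by
    intro n B hB
    have hT : Measurable fun x : Fin n → R => (ofPoints x).1 :=
      (hτ.continuous_ofPoints n).measurable
    rw [← range_ofPoints n]
    refine (hT.measurableSet_preimage_iff_inter_range ?_).1 ?_
    · rw [range_ofPoints]
      exact hQ n
    · rw [← preimage_comp]
      have : extendFin h ∘ (fun x : Fin n → R => (ofPoints x).1) = fun x => h (ofPoints x) :=
        funext fun x => extendFin_coe h (ofPoints x)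
      rw [this]
      exact hh n hB
  intro B hB
  have hsplit : extendFin h ⁻¹' B =
      (⋃ n : ℕ, extendFin h ⁻¹' B ∩ {s : Conf R | s.toMeasure univ = n}) ∪
        ({s : Conf R | s.toMeasure univ = ∞} ∩ {_s : Conf R | (0 : ℝ≥0∞) ∈ B}) := by
    ext s
    simp only [mem_union, mem_iUnion, mem_inter_iff, mem_preimage, mem_ofPred_eq]
    by_cases hs : s.toMeasure univ < ∞
    · obtain ⟨n, hn⟩ := Conf.exists_measure_univ_eq hs
      simp [hn]
    · have hs' : s.toMeasure univ = ∞ := not_lt_top_iff.1 hs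
      have h0 : extendFin h s = 0 := dif_neg hs
      simp [hs', h0]
  rw [hsplit]
  exact (MeasurableSet.iUnion fun n => hpiece n hB).union ((hQ ∞).inter (MeasurableSet.const _))

theorem measurable_innerPart (hτ : IsVagueTopology τ) (o : R) {h : FinConf R → ℝ≥0∞}
    (hh : ∀ n, Measurable fun x : Fin n → R => h (ofPoints x)) (b : ℕ → ℝ) (r : ℕ) :
    Measurable (innerPart h o b r) := by
  have h1 : innerPart h o b r = fun s => extendFin h (inside o (b r) s).1 :=
    funext fun s => (extendFin_coe h (inside o (b r) s)).symm
  rw [h1]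
  refine (measurable_extendFin hτ o hh).comp (hτ.measurable_of_measurable_toMeasure o ?_)
  refine Measure.measurable_of_measurable_coe _ fun B hB => ?_
  have h2 : ∀ s : Conf R, (inside o (b r) s).1.toMeasure B =
      s.toMeasure (B ∩ Metric.ball o (b r)) := fun s => Measure.restrict_apply hB
  simp only [h2]
  exact (Measure.measurable_coe (hB.inter measurableSet_ball)).comp (hτ.measurable_toMeasure o)

end Borel

theorem measurable_ratio_ofPoints
    {f g : FinConf R → ℝ≥0}
    (hf : ∀ n, Continuous fun x : Fin n → R => f (ofPoints x))
    (hg : ∀ n, Continuous fun x : Fin n → R => g (ofPoints x)) (n : ℕ) :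
    Measurable fun x : Fin n → R => ratio f g (ofPoints x) := by
  unfold ratio
  refine Measurable.ite ((hg n).measurable (measurableSet_singleton 0)) measurable_const ?_
  exact ((hf n).measurable.div (hg n).measurable).coe_nnreal_ennreal

omit [BorelSpace R] [SecondCountableTopology R] in
theorem mul_ratio {f g : FinConf R → ℝ≥0} {s : FinConf R} (h : ratio f g s ≠ ∞) :
    (g s : ℝ≥0∞) * ratio f g s = f s := by
  have hg : g s ≠ 0 := by
    intro h0
    exact h (by simp [ratio, h0])
  rw [ratio, if_neg hg, ← ENNReal.coe_mul, mul_div_cancel₀ _ hg]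

end FiniteConfigurations

section ApproximatingSequences

variable {R : Type*} [MetricSpace R] [MeasurableSpace R] [BorelSpace R] [SecondCountableTopology R]
  [τ : TopologicalSpace (Conf R)] [MeasurableSpace (Conf R)] [BorelSpace (Conf R)]
  {m : Measure R} {μ : Measure (Conf R)} {μs : ℕ → Measure (Conf R)} {f : FinConf R → ℝ≥0}

/-- Integration against the law of the `n`-point configuration, in terms of labelled points. -/
theorem IsApproxSeq.lintegral_eq (hτ : IsVagueTopology τ) (h : IsApproxSeq m μ μs f) {n : ℕ}
    (hn : 1 ≤ n) {F : Conf R → ℝ≥0∞} (hF : Measurable F) :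
    ∫⁻ s, F s ∂(μs n) = (partitionFn m f n)⁻¹ *
      ∫⁻ x : Fin n → R, f (ofPoints x) * F (ofPoints x).1 ∂(Measure.pi fun _ => m) := by
  have hT : Measurable fun x : Fin n → R => (ofPoints x).1 :=
      (hτ.continuous_ofPoints n).measurable
  have hf : Measurable fun x : Fin n → R => (f (ofPoints x) : ℝ≥0∞) :=
    (h.continuous n).measurable.coe_nnreal_ennreal
  rw [h.law n hn, lintegral_smul_measure, lintegral_map hF hT, smul_eq_mul]
  exact congrArg _ (lintegral_withDensity_eq_lintegral_mul _ hf (hF.comp hT))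

theorem IsApproxSeq.isProbabilityMeasure (hτ : IsVagueTopology τ) (h : IsApproxSeq m μ μs f)
    {n : ℕ} (hn : 1 ≤ n) : IsProbabilityMeasure (μs n) := by
  refine ⟨?_⟩
  have := h.lintegral_eq hτ hn (F := 1) measurable_one
  simp only [Pi.one_apply, lintegral_one, mul_one] at this
  rw [this]
  exact ENNReal.inv_mul_cancel (h.partitionFn_pos n hn).ne' (h.partitionFn_lt_top n hn).ne

theorem IsApproxSeq.ae_finite (hτ : IsVagueTopology τ) (o : R) (h : IsApproxSeq m μ μs f)
    {n : ℕ} (hn : 1 ≤ n) : ∀ᵐ s ∂(μs n), s.toMeasure univ < ∞ := by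
  have hT : Measurable fun x : Fin n → R => (ofPoints x).1 :=
      (hτ.continuous_ofPoints n).measurable
  have huniv : Measurable fun s : Conf R => s.toMeasure univ :=
    (Measure.measurable_coe MeasurableSet.univ).comp (hτ.measurable_toMeasure o)
  rw [h.law n hn]
  refine Measure.ae_smul_measure ((ae_map_iff hT.aemeasurable
    (measurableSet_lt huniv measurable_const)).2 (Eventually.of_forall fun x => ?_)) _
  exact (ofPoints x).2

end ApproximatingSequences

/-! ### Level sets and the reduction to conditional limits -/

section LevelSets

variable {R : Type*} [MetricSpace R] [MeasurableSpace R] [BorelSpace R]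
  {o : R} {b : ℕ → ℝ} {a : ℕ → ℝ} {h : FinConf R → ℝ≥0∞}

theorem innerPart_bounds {k : ℕ} {s : Conf R} (hs : s ∈ levelSet h o b a k) (r : ℕ) :
    ENNReal.ofReal (a k)⁻¹ ≤ innerPart h o b r s ∧ innerPart h o b r s ≤ ENNReal.ofReal (a k) :=
  ⟨hs.1.trans (iInf_le _ r), (le_iSup (fun r => innerPart h o b r s) r).trans hs.2⟩

/-- On the level sets the product in the factorisation `h = h_r * h_r^c` is always defined. -/
theorem innerPart_deviation_le {k : ℕ} (ha : 0 < a k) {r : ℕ} {s : FinConf R}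
    (hs : s.1 ∈ levelSet h o b a k)
    (hfac : ¬ (innerPart h o b r s.1 = 0 ∧ outerPart h o b r s = ∞) →
      ¬ (innerPart h o b r s.1 = ∞ ∧ outerPart h o b r s = 0) →
      h s = innerPart h o b r s.1 * outerPart h o b r s) :
    (innerPart h o b r s.1 - extendFin h s.1) + (extendFin h s.1 - innerPart h o b r s.1) ≤
      ENNReal.ofReal (a k) * outerDeviation h o b r s.1 := by
  obtain ⟨hlow, hup⟩ := innerPart_bounds hs r
  have h0 : innerPart h o b r s.1 ≠ 0 :=
    ((ENNReal.ofReal_pos.2 (inv_pos.2 ha)).trans_le hlow).ne'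
  have htop : innerPart h o b r s.1 ≠ ∞ := (hup.trans_lt ENNReal.ofReal_lt_top).ne
  rw [extendFin_coe, hfac (fun h => h0 h.1) (fun h => htop h.1), outerDeviation, dif_pos s.2]
  change innerPart h o b r s.1 - innerPart h o b r s.1 * outerPart h o b r s +
    (innerPart h o b r s.1 * outerPart h o b r s - innerPart h o b r s.1) ≤
    ENNReal.ofReal (a k) * ((outerPart h o b r s - 1) + (1 - outerPart h o b r s))
  have h1 : innerPart h o b r s.1 - innerPart h o b r s.1 * outerPart h o b r s =
      innerPart h o b r s.1 * (1 - outerPart h o b r s) := by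
    rw [ENNReal.mul_sub fun _ _ => htop, mul_one]
  have h2 : innerPart h o b r s.1 * outerPart h o b r s - innerPart h o b r s.1 =
      innerPart h o b r s.1 * (outerPart h o b r s - 1) := by
    rw [ENNReal.mul_sub fun _ _ => htop, mul_one]
  rw [h1, h2, ← mul_add, add_comm (1 - outerPart h o b r s)]
  gcongr

theorem extendFin_bounds [SecondCountableTopology R] (hb : Tendsto b atTop atTop) {k : ℕ}
    {s : FinConf R} (hs : s.1 ∈ levelSet h o b a k) :
    ENNReal.ofReal (a k)⁻¹ ≤ extendFin h s.1 ∧ extendFin h s.1 ≤ ENNReal.ofReal (a k) := by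
  obtain ⟨r, hr⟩ := (innerPart_eventually_eq (o := o) hb h s).exists
  rw [extendFin_coe, ← hr]
  exact innerPart_bounds hs r

end LevelSets

section Assembly

variable {R : Type*} [MetricSpace R] [CompleteSpace R] [SecondCountableTopology R]
    [MeasurableSpace R] [BorelSpace R]
    [τ : TopologicalSpace (Conf R)] [MeasurableSpace (Conf R)] [BorelSpace (Conf R)]
    {m : Measure R} {o : R} {b : ℕ → ℝ} {a : ℕ → ℝ}
    {μ ν : Measure (Conf R)} {μs νs : ℕ → Measure (Conf R)} {fμ fν : FinConf R → ℝ≥0}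

omit [CompleteSpace R] in
/-- On the level sets `fν` does not vanish, so that `fμ = h * fν` there and `h` is, up to the
normalisations, the density of `μs n` with respect to `νs n`. -/
theorem restrict_levelSet_eq_withDensity (hτ : IsVagueTopology τ)
    (hb : Tendsto b atTop atTop) (hμ : IsApproxSeq m μ μs fμ) (hν : IsApproxSeq m ν νs fν)
    {k n : ℕ} (hn : 1 ≤ n) (hH : MeasurableSet (levelSet (ratio fμ fν) o b a k))
    (hm : Measurable (extendFin (ratio fμ fν))) :
    (μs n).restrict (levelSet (ratio fμ fν) o b a k) =
      (partitionFn m fν n / partitionFn m fμ n) •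
        ((νs n).restrict (levelSet (ratio fμ fν) o b a k)).withDensity
          (extendFin (ratio fμ fν)) := by
  set H := levelSet (ratio fμ fν) o b a k with hHdef
  refine Measure.ext fun A hA => ?_
  have hAH : MeasurableSet (A ∩ H) := hA.inter hH
  rw [Measure.smul_apply, withDensity_apply _ hA, Measure.restrict_restrict hA,
    Measure.restrict_apply hA, ← lintegral_indicator_one hAH, ← lintegral_indicator hAH,
    hμ.lintegral_eq hτ hn (measurable_one.indicator hAH),
    hν.lintegral_eq hτ hn (hm.indicator hAH), smul_eq_mul, ← mul_assoc]
  congr 1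
  · rw [div_eq_mul_inv, mul_comm, ← mul_assoc, ENNReal.inv_mul_cancel
      (hν.partitionFn_pos n hn).ne' (hν.partitionFn_lt_top n hn).ne, one_mul]
  · refine lintegral_congr fun x => ?_
    by_cases hx : (ofPoints x).1 ∈ A ∩ H
    · rw [indicator_of_mem hx, indicator_of_mem hx, Pi.one_apply, mul_one, extendFin_coe,
        mul_ratio]
      rw [← extendFin_coe (ratio fμ fν)]
      exact ((extendFin_bounds hb hx.2).2.trans_lt ENNReal.ofReal_lt_top).ne
    · rw [indicator_of_notMem hx, indicator_of_notMem hx, mul_zero, mul_zero]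

/-- The hypotheses on the approximating sequences, put into the form used by the limit theorem. -/
theorem isRatioApprox_of_isApproxSeq (hτ : IsVagueTopology τ)
    (hb_lim : Tendsto b atTop atTop) (ha_pos : ∀ k, 0 < a k)
    (hcont : ∀ r, ν {s | ¬ ContinuousAt (innerPart (ratio fμ fν) o b r) s} = 0)
    (hμ : IsApproxSeq m μ μs fμ) (hν : IsApproxSeq m ν νs fν)
    (hexh_mu : Tendsto (fun k => liminf (fun n => μs n (levelSet (ratio fμ fν) o b a k)) atTop)
      atTop (𝓝 1))
    (hexh_nu : Tendsto (fun k => liminf (fun n => νs n (levelSet (ratio fμ fν) o b a k)) atTop)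
      atTop (𝓝 1))
    (hfac : ∀ (r : ℕ) (s : FinConf R),
      ¬ (innerPart (ratio fμ fν) o b r s.1 = 0 ∧ outerPart (ratio fμ fν) o b r s = ∞) →
      ¬ (innerPart (ratio fμ fν) o b r s.1 = ∞ ∧ outerPart (ratio fμ fν) o b r s = 0) →
      ratio fμ fν s = innerPart (ratio fμ fν) o b r s.1 * outerPart (ratio fμ fν) o b r s)
    (hdev : ∀ k, Tendsto
      (fun r => ⨆ n : ℕ, ⨆ _ : 1 ≤ n, ∫⁻ s, outerDeviation (ratio fμ fν) o b r s
        ∂(ProbabilityTheory.cond (νs n) (levelSet (ratio fμ fν) o b a k))) atTop (𝓝 0)) :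
    IsRatioApprox μ ν μs νs (levelSet (ratio fμ fν) o b a) a (innerPart (ratio fμ fν) o b)
      (extendFin (ratio fμ fν)) (fun n => partitionFn m fν n / partitionFn m fμ n) := by
  have hpts := measurable_ratio_ofPoints hμ.continuous hν.continuous
  have hinner := measurable_innerPart hτ o hpts b
  have hext := measurable_extendFin hτ o hpts
  have hH : ∀ k, MeasurableSet (levelSet (ratio fμ fν) o b a k) := fun k =>
    (measurableSet_le measurable_const (Measurable.iInf hinner)).inter
      (measurableSet_le (Measurable.iSup hinner) measurable_const)
  refine
    { isProb_mu := fun n hn => hμ.isProbabilityMeasure hτ hn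
      isProb_nu := fun n hn => hν.isProbabilityMeasure hτ hn
      weakly_mu := hμ.weakly
      weakly_nu := hν.weakly
      measurableSet := hH
      pos := ha_pos
      measurable := hinner
      measurable_lim := hext
      continuousAt := hcont
      le := fun k s hs r => (innerPart_bounds hs r).1
      ge := fun k s hs r => (innerPart_bounds hs r).2
      le_lim := fun k n hn => ?_
      z_ne_top := fun n hn => ENNReal.div_ne_top (hν.partitionFn_lt_top n hn).ne
        (hμ.partitionFn_pos n hn).ne'
      density := fun k n hn => restrict_levelSet_eq_withDensity hτ hb_lim hμ hν hn (hH k) hext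
      exhaust_mu := hexh_mu
      exhaust_nu := hexh_nu
      deviation := fun k => ?_ }
  · filter_upwards [hν.ae_finite hτ o hn] with s hs hsH
    exact extendFin_bounds (s := ⟨s, hs⟩) hb_lim hsH
  · have hbig := ENNReal.Tendsto.const_mul (a := ENNReal.ofReal (a k)) (hdev k)
      (Or.inr ENNReal.ofReal_ne_top)
    rw [mul_zero] at hbig
    refine tendsto_of_tendsto_of_tendsto_of_le_of_le tendsto_const_nhds hbig
      (fun r => zero_le) fun r => iSup₂_le fun n hn => ?_
    refine le_trans (lintegral_mono_ae (g := fun s => ENNReal.ofReal (a k) *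
      outerDeviation (ratio fμ fν) o b r s) ?_) ?_
    · have hac : ProbabilityTheory.cond (νs n) (levelSet (ratio fμ fν) o b a k) ≪ νs n :=
        ProbabilityTheory.cond_absolutelyContinuous
      filter_upwards [ProbabilityTheory.ae_cond_mem (hH k), hac.ae_le (hν.ae_finite hτ o hn)]
        with s hsH hs
      exact innerPart_deviation_le (s := ⟨s, hs⟩) (ha_pos k) hsH (hfac r ⟨s, hs⟩)
    · rw [lintegral_const_mul' _ _ ENNReal.ofReal_ne_top]
      gcongr
      exact le_iSup₂_of_le (f := fun n (_ : 1 ≤ n) => ∫⁻ s, outerDeviation (ratio fμ fν) o b r s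
        ∂(ProbabilityTheory.cond (νs n) (levelSet (ratio fμ fν) o b a k))) n hn le_rfl

end Assembly

/-! ### The limit theorem for approximating sequences -/

theorem theoreml {R : Type*} [MetricSpace R] [CompleteSpace R] [SecondCountableTopology R]
    [MeasurableSpace R] [BorelSpace R]
    (hR : ¬ Bornology.IsBounded (Set.univ : Set R))
    -- the vague topology and its Borel sets on the locally finite configurations
    [τ : TopologicalSpace (Conf R)] (hτ : IsVagueTopology τ)
    [MeasurableSpace (Conf R)] [BorelSpace (Conf R)]
    -- the reference measure, the balls `S_r`, and the levels `a_k`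
    (m : Measure R) [IsLocallyFiniteMeasure m]
    (o : R) (b : ℕ → ℝ) (hb_pos : ∀ r, 0 < b r) (hb_mono : Monotone b)
    (hb_lim : Tendsto b atTop atTop)
    (a : ℕ → ℝ) (ha_pos : ∀ k, 0 < a k) (ha_mono : Monotone a)
    -- the two point processes, their approximations, and the ratio `h` of the densities
    (μ ν : Measure (Conf R)) [IsProbabilityMeasure μ] [IsProbabilityMeasure ν]
    (μs νs : ℕ → Measure (Conf R)) (fμ fν : FinConf R → ℝ≥0)
    (h : FinConf R → ℝ≥0∞) (hh : h = ratio fμ fν)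
    -- (A1)
    (A1_proj : ∀ r, μ {s | ¬ ContinuousAt (fun s => (inside o (b r) s).1) s} = 0 ∧
      ν {s | ¬ ContinuousAt (fun s => (inside o (b r) s).1) s} = 0)
    (A1_inner : ∀ r, μ {s | ¬ ContinuousAt (innerPart h o b r) s} = 0 ∧
      ν {s | ¬ ContinuousAt (innerPart h o b r) s} = 0)
    -- (A2)
    (A2_mu : IsApproxSeq m μ μs fμ) (A2_nu : IsApproxSeq m ν νs fν)
    -- (A3)
    (A3_mu : Tendsto (fun k => liminf (fun n => μs n (levelSet h o b a k)) atTop) atTop (𝓝 1))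
    (A3_nu : Tendsto (fun k => liminf (fun n => νs n (levelSet h o b a k)) atTop) atTop (𝓝 1))
    -- (A4), wherever the product on the right is not of the form `0 * ∞`
    (A4 : ∀ (r : ℕ) (s : FinConf R),
      ¬ (innerPart h o b r s.1 = 0 ∧ outerPart h o b r s = ∞) →
      ¬ (innerPart h o b r s.1 = ∞ ∧ outerPart h o b r s = 0) →
      h s = innerPart h o b r s.1 * outerPart h o b r s)
    -- (A5)
    (A5 : ∀ k, Tendsto
      (fun r => ⨆ n : ℕ, ⨆ _ : 1 ≤ n, ∫⁻ s, outerDeviation h o b r s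
        ∂(ProbabilityTheory.cond (νs n) (levelSet h o b a k))) atTop (𝓝 0)) :
    -- the conditional laws have limits along a common subsequence, for all large `k`
    (∃ (n : ℕ → ℕ) (νlim : ℕ → Measure (Conf R)) (k₀ : ℕ), ∀ k, k₀ ≤ k →
      IsConditionalLimit νs (levelSet h o b a k) n (νlim k)) ∧
    ∃ (hinf : Conf R → ℝ) (ζ : ℝ),
      Integrable hinf ν ∧ 0 ≤ᵐ[ν] hinf ∧
      -- `hinf` is the weak limit of `h_r` in `L¹` of every such limit law
      (∀ (k : ℕ) (n : ℕ → ℕ) (νk : Measure (Conf R)),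
        IsConditionalLimit νs (levelSet h o b a k) n νk →
        WeakL1Limit νk (innerPart h o b) hinf) ∧
      -- and it is determined by this, along any fixed subsequence
      (∀ (n : ℕ → ℕ) (νlim : ℕ → Measure (Conf R)) (k₀ : ℕ),
        (∀ k, k₀ ≤ k → IsConditionalLimit νs (levelSet h o b a k) n (νlim k)) →
        ∀ g : Conf R → ℝ, Integrable g ν →
          (∀ k, k₀ ≤ k → WeakL1Limit (νlim k) (innerPart h o b) g) → g =ᵐ[ν] hinf) ∧
      -- `ζ` is the limit of the ratio of the normalisations
      0 < ζ ∧
      Tendsto (fun n => partitionFn m fν n / partitionFn m fμ n) atTop (𝓝 (ENNReal.ofReal ζ)) ∧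
      -- absolute continuity, with the density `ζ * hinf`
      μ ≪ ν ∧ μ.rnDeriv ν =ᵐ[ν] fun s => ENNReal.ofReal (ζ * hinf s) := by
  subst hh
  obtain ⟨_, _, _⟩ := hτ.secondCountable_regular_t0 o
  exact (isRatioApprox_of_isApproxSeq hτ hb_lim ha_pos (fun r => (A1_inner r).2) A2_mu A2_nu A3_mu
    A3_nu A4 A5).exists_density_limit
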